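/- Let $m\ge 1$ be an integer and $\mathcal X$ a measurable space. For every $n\ge 1$ let $X_{n,1},\dots,X_{n,n}$ be independent $\mathcal X$-valued random variables (defined on a probability space that may depend on $n$), with laws $P_{n,1},\dots,P_{n,n}$ that need not be equal; let $a_n:[n]^m\to\mathbb R$ be a weight function and $h_n:\mathcal X^m\to\mathbb R$ a measurable kernel, neither of which is assumed symmetric. We drop the index $n$ and write $[n]=\{1,\dots,n\}$. Let $I_n^m$ be the set of $m$-tuples of pairwise distinct elements of $[n]$ and, for $n\ge m$, $$U_n=\frac{(n-m)!}{n!}\sum_{(i_1,\dots,i_m)\in I_n^m}a(i_1,\dots,i_m)\,h(X_{i_1},\dots,X_{i_m}).$$ For $l\in[m]$ let $\pi_l(y;y_1,\dots,y_{m-1})=(y_1,\dots,y_{l-1},y,y_l,\dots,y_{m-1})$. Put $$\theta(i_1,\dots,i_m)=\int h(y_1,\dots,y_m)\,dP_{i_1}(y_1)\cdots dP_{i_m}(y_m),$$ $$f^{(l)}_{i_1,\dots,i_{m-1}}(x)=\int h(\pi_l(x;y_1,\dots,y_{m-1}))\,dP_{i_1}(y_1)\cdots dP_{i_{m-1}}(y_{m-1}),$$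 $$h_{1,i}(x)=\frac{(n-m)!}{(n-1)!}\sum\;\sum_{l=1}^m a(\pi_l(i;i_1,\dots,i_{m-1}))\big\{f^{(l)}_{i_1,\dots,i_{m-1}}(x)-\theta(\pi_l(i;i_1,\dots,i_{m-1}))\big\},$$ where the outer sum in the last line is over all $(m-1)$-tuples $(i_1,\dots,i_{m-1})$ of pairwise distinct elements of $[n]\setminus\{i\}$. Let $$V(n)=\mathrm{Var}\Big(\frac1n\sum_{i=1}^n h_{1,i}(X_i)\Big).$$ For integers $K\ge 2$ and $q\ge 0$ let $(I_n^m)^{\otimes K}_{\ge q}$ be the set of all $K$-tuples $(\mathbf i^{(1)},\dots,\mathbf i^{(K)})$ of elements of $I_n^m$ such that at least $q$ elements of $[n]$ occur as entries of every one of $\mathbf i^{(1)},\dots,\mathbf i^{(K)}$, and let $$A_{K,q}(n)=\frac{1}{\mathrm{card}\{(I_n^m)^{\otimes K}_{\ge q}\}}\sum_{(\mathbf i^{(1)},\dots,\mathbf i^{(K)})\in (I_n^m)^{\otimes K}_{\ge q}}\big|a(\mathbf i^{(1)})\cdots a(\mathbf i^{(K)})\big|,$$ read as $0$ if this set is empty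 (as it is for $m=1$, $q=2$). **Theorem (sufficient condition for asymptotic normality of $U_n$).** For each $n$ let $M(n)>0$ be a constant with $$\max_{(i_1,\dots,i_m)\in I_n^m}E\{h(X_{i_1},\dots,X_{i_m})^4\}\le M(n).$$ Assume that $V(n)>0$ for all sufficiently large $n$ and that, as $n\to\infty$, $$n^{-2}V(n)^{-1}A_{2,2}(n)M(n)^{1/2}\to0\qquad\text{and}\qquad n^{-2}V(n)^{-3/2}A_{3,1}(n)M(n)^{3/4}\to0.$$ Then $$\mathrm{Var}(U_n)/V(n)\to1\qquad\text{and}\qquad \mathrm{Var}(U_n)^{-1/2}\{U_n-E(U_n)\}\xrightarrow{d}N(0,1).$$ -/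

import Mathlib

open MeasureTheory ProbabilityTheory Filter Topology

noncomputable section

namespace WeightedU

/-- `I_n^m`: the `m`-tuples of pairwise distinct indices (indices run over `Fin n`). -/
def indexSet (n m : ℕ) : Finset (Fin m → Fin n) :=
  Finset.univ.filter fun t => Function.Injective t

/-- `I_{n-1}^{k}(-i)`: the `k`-tuples of pairwise distinct indices, all different from `i`. -/
def indexSetExcept (n k : ℕ) (i : Fin n) : Finset (Fin k → Fin n) :=
  Finset.univ.filter fun t => Function.Injective t ∧ ∀ j, t j ≠ i

/-- The indices that occur in every one of the tuples `t 0, …, t (K - 1)`. -/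
def commonIndices {n m K : ℕ} (t : Fin K → Fin m → Fin n) : Finset (Fin n) :=
  Finset.univ.filter fun i => ∀ k, ∃ j, t k j = i

/-- `(I_n^m)_{≥ q}^{⊗ K}`: the `K`-tuples of elements of `I_n^m` that share at least `q` indices. -/
def sharingSet (n m K q : ℕ) : Finset (Fin K → Fin m → Fin n) :=
  Finset.univ.filter fun t => (∀ k, t k ∈ indexSet n m) ∧ q ≤ (commonIndices t).card

/-- The average weight `A_{K,q}(n)` of a weight function `a`. -/
def avgWeight {n m : ℕ} (a : (Fin m → Fin n) → ℝ) (K q : ℕ) : ℝ :=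
  ((sharingSet n m K q).card : ℝ)⁻¹ * ∑ t ∈ sharingSet n m K q, |∏ k, a (t k)|

variable {𝓧 : Type*}

/-- The weighted U-statistic of degree `m` evaluated at the sample `x`. -/
def uStat {n m : ℕ} (a : (Fin m → Fin n) → ℝ) (h : (Fin m → 𝓧) → ℝ) (x : Fin n → 𝓧) : ℝ :=
  ((n - m).factorial : ℝ) / (n.factorial : ℝ) *
    ∑ t ∈ indexSet n m, a t * h fun j => x (t j)

variable [MeasurableSpace 𝓧]

/-- `θ(i_1, …, i_m) = ∫ h(y_1, …, y_m) dP_{i_1}(y_1) ⋯ dP_{i_m}(y_m)`. -/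
def theta {n m : ℕ} (h : (Fin m → 𝓧) → ℝ) (P : Fin n → Measure 𝓧) (t : Fin m → Fin n) : ℝ :=
  ∫ y, h y ∂(Measure.pi fun j => P (t j))

/-- `f^{(l)}_{i_1, …, i_{m-1}}(x)`, with `m = k + 1`: the integral of `h` over all arguments but
the `l`-th one, which is set to `x`. -/
def proj {n k : ℕ} (h : (Fin (k + 1) → 𝓧) → ℝ) (P : Fin n → Measure 𝓧) (l : Fin (k + 1))
    (t : Fin k → Fin n) (x : 𝓧) : ℝ :=
  ∫ y : Fin k → 𝓧, h (l.insertNth x y) ∂(Measure.pi fun j => P (t j))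

/-- `h_{1,i;i_1, …, i_{m-1}}(x)`, with `m = k + 1`. -/
def firstOrderAt {n k : ℕ} (a : (Fin (k + 1) → Fin n) → ℝ) (h : (Fin (k + 1) → 𝓧) → ℝ)
    (P : Fin n → Measure 𝓧) (i : Fin n) (t : Fin k → Fin n) (x : 𝓧) : ℝ :=
  ∑ l : Fin (k + 1), a (l.insertNth i t) * (proj h P l t x - theta h P (l.insertNth i t))

/-- `h_{1,i}(x)`, with `m = k + 1`: the first order expansion of `h` for the `i`-th variable. -/
def firstOrder {n k : ℕ} (a : (Fin (k + 1) → Fin n) → ℝ) (h : (Fin (k + 1) → 𝓧) → ℝ)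
    (P : Fin n → Measure 𝓧) (i : Fin n) (x : 𝓧) : ℝ :=
  ((n - (k + 1)).factorial : ℝ) / ((n - 1).factorial : ℝ) *
    ∑ t ∈ indexSetExcept n k i, firstOrderAt a h P i t x

/-- `V(n) = Var(n⁻¹ ∑ i, h_{1,i}(X_i))`, where `P_i` is the law of `X_i`. -/
def mainVar {Ω : Type*} [MeasurableSpace Ω] {n k : ℕ} (a : (Fin (k + 1) → Fin n) → ℝ)
    (h : (Fin (k + 1) → 𝓧) → ℝ) (μ : Measure Ω) (X : Fin n → Ω → 𝓧) : ℝ :=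
  variance (fun ω => (n : ℝ)⁻¹ * ∑ i, firstOrder a h (fun j => μ.map (X j)) i (X i ω)) μ

end WeightedU

end

/-!
Since the observations are independent, `n⁻¹ ∑ i, h_{1,i}(X_i)` is the Hájek projection of
`U_n - E U_n`, and the residual `R_n` is uncorrelated with it, so `Var U_n = V(n) + E R_n ^ 2`.
By linearity `R_n` is a weighted sum of the residuals of the single kernels `h(X_i)`, `i ∈ I_n^m`.
The residuals of two kernels that share at most one index are uncorrelated, because each consists
of interactions of at least two of its own coordinates. Hence only the pairs counted by `A_{2,2}`
contribute to `E R_n ^ 2`. In the same way, the third absolute moment of the `i`-th summand of the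
projection involves only triples of kernels that all contain the index `i`, so the Lyapunov sum is
controlled by `A_{3,1}`.

To pass from sums to averages, choose the positions of the `q` common indices in each of the `K`
tuples: `q (K - 1)` entries are then determined by the rest, so that at most
`m ^ (q K) n ^ (K m - q (K - 1))` such `K`-tuples exist. This is the source of the factor `n ^ (-2)`
in both conditions, where `q (K - 1) = 2`.

The central limit theorem for the projection follows from a third order Taylor expansion of the
characteristic functions of its summands. It needs only third moments of the kernels.
-/

namespace WeightedU

section Moments

variable {Ω : Type*} [MeasurableSpace Ω] {μ : Measure Ω}

theorem integral_abs_pow_eq_lpNorm_pow {f : Ω → ℝ} {K : ℕ} (hK : K ≠ 0)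
    (hf : AEStronglyMeasurable f μ) : ∫ ω, |f ω| ^ K ∂μ = lpNorm f K μ ^ K := by
  rw [lpNorm_eq_integral_norm_rpow_toReal (by exact_mod_cast hK) (by simp) hf]
  simp only [ENNReal.toReal_natCast, Real.rpow_natCast, Real.norm_eq_abs]
  rw [Real.rpow_inv_natCast_pow (by positivity) hK]

theorem integral_sq_eq_lpNorm_sq {f : Ω → ℝ} (hf : AEStronglyMeasurable f μ) :
    ∫ ω, f ω ^ 2 ∂μ = lpNorm f 2 μ ^ 2 := by
  simpa using integral_abs_pow_eq_lpNorm_pow two_ne_zero hf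

theorem integral_abs_cube_eq_lpNorm_cube {f : Ω → ℝ} (hf : AEStronglyMeasurable f μ) :
    ∫ ω, |f ω| ^ 3 ∂μ = lpNorm f 3 μ ^ 3 := by
  simpa using integral_abs_pow_eq_lpNorm_pow three_ne_zero hf

theorem memLp_of_integrable_abs_pow {f : Ω → ℝ} {K : ℕ} (hK : K ≠ 0)
    (hf : AEStronglyMeasurable f μ) (hint : Integrable (fun ω => |f ω| ^ K) μ) : MemLp f K μ := by
  rw [← integrable_norm_rpow_iff hf (by exact_mod_cast hK) (by simp)]
  simpa using hint

theorem lpNorm_le_rpow_inv_of_integral_abs_pow_le {f : Ω → ℝ} {K : ℕ} {C : ℝ} (hK : K ≠ 0)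
    (hf : AEStronglyMeasurable f μ) (hC : ∫ ω, |f ω| ^ K ∂μ ≤ C) :
    lpNorm f K μ ≤ C ^ (K⁻¹ : ℝ) := by
  rw [integral_abs_pow_eq_lpNorm_pow hK hf] at hC
  have h := Real.rpow_le_rpow (pow_nonneg lpNorm_nonneg K) hC (by positivity : 0 ≤ (K : ℝ)⁻¹)
  rwa [Real.pow_rpow_inv_natCast lpNorm_nonneg hK] at h

theorem memLp_and_lpNorm_le_of_measurePreserving {Ω' : Type*} [MeasurableSpace Ω']
    {ν : Measure Ω'} {g : Ω → Ω'} {f : Ω' → ℝ} {K : ℕ} {C : ℝ} (hK : K ≠ 0)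
    (hg : MeasurePreserving g μ ν) (hf : AEStronglyMeasurable f ν)
    (hint : Integrable (fun ω => |f (g ω)| ^ K) μ)
    (hC : ∫ ω, |f (g ω)| ^ K ∂μ ≤ C) : MemLp f K ν ∧ lpNorm f K ν ≤ C ^ (K⁻¹ : ℝ) := by
  have hpow : AEStronglyMeasurable (fun x => |f x| ^ K) ν := by fun_prop
  rw [← hg.map_eq] at hpow
  rw [← integral_map hg.aemeasurable hpow, hg.map_eq] at hC
  have hint' := (integrable_map_measure hpow hg.aemeasurable).2 hint
  rw [hg.map_eq] at hint'
  exact ⟨memLp_of_integrable_abs_pow hK hf hint',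
    lpNorm_le_rpow_inv_of_integral_abs_pow_le hK hf hC⟩

theorem integrable_prod_of_memLp {κ : Type*} [Fintype κ] [Nonempty κ] {f : κ → Ω → ℝ}
    (hf : ∀ k, MemLp (f k) (Fintype.card κ) μ) : Integrable (fun ω => ∏ k, f k ω) μ := by
  have hcard : (Fintype.card κ : ENNReal) * (Fintype.card κ : ENNReal)⁻¹ = 1 :=
    ENNReal.mul_inv_cancel (by simp) (by simp)
  exact memLp_one_iff_integrable.1 <| by
    simpa [hcard] using MemLp.prod' (s := Finset.univ) fun k _ => hf k

theorem integral_abs_prod_le_pow {κ : Type*} [Fintype κ] [Nonempty κ] {f : κ → Ω → ℝ} {B : ℝ}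
    (hf : ∀ k, MemLp (f k) (Fintype.card κ) μ)
    (hB : ∀ k, lpNorm (f k) (Fintype.card κ) μ ≤ B) :
    ∫ ω, |∏ k, f k ω| ∂μ ≤ B ^ Fintype.card κ := by
  have hcard : (Fintype.card κ : ℝ) ≠ 0 := by simp
  have hint : ∀ k, Integrable (fun ω => |f k ω| ^ Fintype.card κ) μ := fun k => by
    simpa using (hf k).integrable_norm_pow Fintype.card_ne_zero
  have amgm : ∀ ω, |∏ k, f k ω|
      ≤ ∑ k, (Fintype.card κ : ℝ)⁻¹ * |f k ω| ^ Fintype.card κ := fun ω => by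
    rw [Finset.abs_prod]
    convert Real.geom_mean_le_arith_mean_weighted Finset.univ (fun _ : κ => (Fintype.card κ : ℝ)⁻¹)
      (fun k => |f k ω| ^ Fintype.card κ) (fun _ _ => by positivity)
      (by simp [hcard]) (fun _ _ => by positivity) using 2 with k
    rw [Real.pow_rpow_inv_natCast (abs_nonneg _) Fintype.card_ne_zero]
  calc ∫ ω, |∏ k, f k ω| ∂μ
      ≤ ∫ ω, ∑ k, (Fintype.card κ : ℝ)⁻¹ * |f k ω| ^ Fintype.card κ ∂μ :=
        integral_mono (integrable_prod_of_memLp hf).abs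
          (integrable_finsetSum _ fun k _ => (hint k).const_mul _) amgm
    _ = ∑ k, (Fintype.card κ : ℝ)⁻¹ * lpNorm (f k) (Fintype.card κ) μ ^ Fintype.card κ := by
        rw [integral_finsetSum _ fun k _ => (hint k).const_mul _]
        simp only [integral_const_mul,
          integral_abs_pow_eq_lpNorm_pow Fintype.card_ne_zero (hf _).aestronglyMeasurable]
    _ ≤ ∑ _k : κ, (Fintype.card κ : ℝ)⁻¹ * B ^ Fintype.card κ := by
        gcongr with k
        exacts [lpNorm_nonneg, hB k]
    _ = B ^ Fintype.card κ := by simp [hcard]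

theorem integral_pow_weighted_sum_le {β : Type*} {τ : Finset β} {K : ℕ} [NeZero K] {B : ℝ}
    {f : β → Ω → ℝ} (w : β → ℝ) (Q : (Fin K → β) → Prop) [DecidablePred Q]
    (hf : ∀ t ∈ τ, MemLp (f t) K μ) (hB : ∀ t ∈ τ, lpNorm (f t) K μ ≤ B)
    (hQ : ∀ p : Fin K → β, (∀ k, p k ∈ τ) → ¬Q p → ∫ ω, ∏ k, f (p k) ω ∂μ = 0) :
    ∫ ω, (∑ t ∈ τ, w t * f t ω) ^ K ∂μ
      ≤ B ^ K * ∑ p ∈ Fintype.piFinset (fun _ : Fin K => τ) with Q p, |∏ k, w (p k)| := by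
  have hcard : (Fintype.card (Fin K) : ENNReal) = K := by rw [Fintype.card_fin]
  have hint : ∀ p ∈ Fintype.piFinset fun _ : Fin K => τ, Integrable (fun ω => ∏ k, f (p k) ω) μ :=
    fun p hp => integrable_prod_of_memLp fun k => hcard ▸ hf _ (Fintype.mem_piFinset.1 hp k)
  have hterm : ∀ p ∈ Fintype.piFinset fun _ : Fin K => τ,
      (∏ k, w (p k)) * ∫ ω, ∏ k, f (p k) ω ∂μ ≤ B ^ K * |∏ k, w (p k)| := fun p hp => by
    rw [Fintype.mem_piFinset] at hp
    have hholder : |∫ ω, ∏ k, f (p k) ω ∂μ| ≤ B ^ K := by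
      simpa using abs_integral_le_integral_abs.trans (integral_abs_prod_le_pow
        (f := fun k => f (p k)) (fun k => hcard ▸ hf _ (hp k)) fun k => hcard ▸ hB _ (hp k))
    calc (∏ k, w (p k)) * ∫ ω, ∏ k, f (p k) ω ∂μ
        ≤ |∏ k, w (p k)| * |∫ ω, ∏ k, f (p k) ω ∂μ| := (le_abs_self _).trans (abs_mul _ _).le
      _ ≤ |∏ k, w (p k)| * B ^ K := by gcongr
      _ = B ^ K * |∏ k, w (p k)| := mul_comm _ _
  calc ∫ ω, (∑ t ∈ τ, w t * f t ω) ^ K ∂μ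
      = ∑ p ∈ Fintype.piFinset fun _ : Fin K => τ, (∏ k, w (p k)) * ∫ ω, ∏ k, f (p k) ω ∂μ := by
        simp only [Finset.sum_pow', Finset.prod_mul_distrib]
        rw [integral_finsetSum _ fun p hp => (hint p hp).const_mul _]
        simp only [integral_const_mul]
    _ = ∑ p ∈ Fintype.piFinset (fun _ : Fin K => τ) with Q p,
          (∏ k, w (p k)) * ∫ ω, ∏ k, f (p k) ω ∂μ := by
        refine (Finset.sum_filter_of_ne fun p hp hne => ?_).symm
        by_contra hQp
        exact hne (by rw [hQ p (Fintype.mem_piFinset.1 hp) hQp, mul_zero])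
    _ ≤ ∑ p ∈ Fintype.piFinset (fun _ : Fin K => τ) with Q p, B ^ K * |∏ k, w (p k)| :=
        Finset.sum_le_sum fun p hp =>
          hterm p (Finset.mem_filter.1 hp).1
    _ = B ^ K * ∑ p ∈ Fintype.piFinset (fun _ : Fin K => τ) with Q p, |∏ k, w (p k)| :=
        (Finset.mul_sum _ _ _).symm

variable [IsProbabilityMeasure μ]

theorem lpNorm_le_lpNorm_of_exponent_le {f : Ω → ℝ} {p q : ENNReal} (hpq : p ≤ q)
    (hf : MemLp f q μ) : lpNorm f p μ ≤ lpNorm f q μ := by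
  rw [← toReal_eLpNorm hf.aestronglyMeasurable, ← toReal_eLpNorm hf.aestronglyMeasurable]
  exact ENNReal.toReal_mono hf.eLpNorm_ne_top
    (eLpNorm_le_eLpNorm_of_exponent_le hpq hf.aestronglyMeasurable)

theorem integrable_abs_cube_and_integral_le_rpow {f : Ω → ℝ} {C : ℝ}
    (hf : AEStronglyMeasurable f μ) (hint : Integrable (fun ω => f ω ^ 4) μ)
    (hC : ∫ ω, f ω ^ 4 ∂μ ≤ C) :
    Integrable (fun ω => |f ω| ^ 3) μ ∧ ∫ ω, |f ω| ^ 3 ∂μ ≤ C ^ (3 / 4 : ℝ) := by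
  have habs (ω : Ω) : f ω ^ 4 = |f ω| ^ 4 := (Even.pow_abs (by decide) _).symm
  simp only [habs] at hint hC
  have h4 : MemLp f 4 μ := memLp_of_integrable_abs_pow four_ne_zero hf hint
  have h3 : MemLp f 3 μ := h4.mono_exponent (by norm_num)
  have hC0 : 0 ≤ C := (integral_nonneg fun ω => by positivity).trans hC
  refine ⟨by simpa using h3.integrable_norm_pow three_ne_zero, ?_⟩
  calc ∫ ω, |f ω| ^ 3 ∂μ = lpNorm f 3 μ ^ 3 := integral_abs_cube_eq_lpNorm_cube hf
    _ ≤ (C ^ (4⁻¹ : ℝ)) ^ 3 := by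
        gcongr
        · exact lpNorm_nonneg
        · exact (lpNorm_le_lpNorm_of_exponent_le (by norm_num) h4).trans
            (lpNorm_le_rpow_inv_of_integral_abs_pow_le four_ne_zero hf hC)
    _ = C ^ (3 / 4 : ℝ) := by
        rw [← Real.rpow_natCast, ← Real.rpow_mul hC0]
        norm_num

theorem lpNorm_integral_le {f : Ω → ℝ} {p : ENNReal} (hp : 1 ≤ p) (hf : MemLp f p μ) :
    lpNorm (fun _ => ∫ ω, f ω ∂μ) p μ ≤ lpNorm f p μ := by
  rw [lpNorm_const (zero_lt_one.trans_le hp).ne' (IsProbabilityMeasure.ne_zero μ),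
    probReal_univ, Real.one_rpow, mul_one, Real.norm_eq_abs]
  exact (abs_integral_le_integral_abs.trans_eq
    (lpNorm_one_eq_integral_norm hf.aestronglyMeasurable).symm).trans
    (lpNorm_le_lpNorm_of_exponent_le hp hf)

end Moments

section CharacteristicFunction

theorem norm_prod_sub_prod_le_sum {ι : Type*} (s : Finset ι) (f g : ι → ℂ)
    (hf : ∀ i, ‖f i‖ ≤ 1) (hg : ∀ i, ‖g i‖ ≤ 1) :
    ‖∏ i ∈ s, f i - ∏ i ∈ s, g i‖ ≤ ∑ i ∈ s, ‖f i - g i‖ := by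
  induction s using Finset.cons_induction with
  | empty => simp
  | cons a s ha ih =>
    rw [Finset.prod_cons, Finset.prod_cons, Finset.sum_cons]
    have hprod : ‖∏ i ∈ s, f i‖ ≤ 1 := by
      rw [norm_prod]
      exact Finset.prod_le_one (fun i _ => norm_nonneg _) fun i _ => hf i
    calc ‖f a * ∏ i ∈ s, f i - g a * ∏ i ∈ s, g i‖
        = ‖(f a - g a) * ∏ i ∈ s, f i + g a * (∏ i ∈ s, f i - ∏ i ∈ s, g i)‖ := by ring_nf
      _ ≤ ‖f a - g a‖ * ‖∏ i ∈ s, f i‖ + ‖g a‖ * ‖∏ i ∈ s, f i - ∏ i ∈ s, g i‖ := by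
          exact (norm_add_le _ _).trans_eq (by simp only [norm_mul])
      _ ≤ ‖f a - g a‖ + ∑ i ∈ s, ‖f i - g i‖ :=
          add_le_add (mul_le_of_le_one_right (norm_nonneg _) hprod)
            ((mul_le_of_le_one_left (norm_nonneg _) (hg a)).trans ih)

theorem norm_cexp_mul_I_sub_taylor_le (x : ℝ) :
    ‖Complex.exp (x * Complex.I) - (1 + x * Complex.I - (x : ℂ) ^ 2 / 2)‖ ≤ 4 * |x| ^ 3 := by
  have hnorm : ‖(x : ℂ) * Complex.I‖ = |x| := by simp
  rcases le_total |x| 1 with hx | hx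
  · have htaylor : ∑ m ∈ Finset.range 3, ((x : ℂ) * Complex.I) ^ m / (m.factorial : ℂ)
        = 1 + x * Complex.I - (x : ℂ) ^ 2 / 2 := by
      simp only [Finset.sum_range_succ, Finset.sum_range_zero, Nat.factorial, mul_pow,
        Complex.I_sq]
      push_cast
      ring
    have hbound := Complex.exp_bound (x := x * Complex.I) (hnorm.le.trans hx) (n := 3) (by norm_num)
    rw [htaylor, hnorm] at hbound
    refine hbound.trans ?_
    rw [mul_comm]
    gcongr
    norm_num [Nat.factorial]
  · have htaylor : ‖(1 + x * Complex.I - (x : ℂ) ^ 2 / 2)‖ ≤ 1 + |x| + |x| ^ 2 / 2 := by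
      refine (norm_sub_le _ _).trans (add_le_add ((norm_add_le _ _).trans ?_) ?_) <;> simp
    refine (norm_sub_le _ _).trans ?_
    rw [Complex.norm_exp_ofReal_mul_I]
    have hsq : |x| ≤ |x| ^ 2 := by nlinarith
    have hcube : |x| ^ 2 ≤ |x| ^ 3 := by nlinarith
    linarith

theorem abs_one_sub_sq_sub_exp_neg_sq_le (x : ℝ) :
    |1 - x ^ 2 - Real.exp (-x ^ 2)| ≤ |x| ^ 3 := by
  have hlower : 1 - x ^ 2 ≤ Real.exp (-x ^ 2) := by linarith [Real.add_one_le_exp (-x ^ 2)]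
  have hcube : |x| ^ 3 = x ^ 2 * |x| := by rw [← sq_abs]; ring
  rw [abs_of_nonpos (by linarith), hcube]
  rcases le_total |x| 1 with hx | hx
  · have hsq : x ^ 2 ≤ |x| := by rw [← sq_abs]; nlinarith [abs_nonneg x]
    have hquad := Real.norm_exp_sub_one_sub_id_le (x := -x ^ 2)
      (by rw [Real.norm_eq_abs, abs_neg, abs_of_nonneg (sq_nonneg x)]; linarith)
    simp only [Real.norm_eq_abs, abs_neg, abs_of_nonneg (sq_nonneg x)] at hquad
    nlinarith [le_abs_self (Real.exp (-x ^ 2) - 1 - -x ^ 2), sq_nonneg x]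
  · have hexp : Real.exp (-x ^ 2) ≤ 1 := Real.exp_le_one_iff.2 (by nlinarith)
    nlinarith [sq_nonneg x]

variable {Ω : Type*} [MeasurableSpace Ω] {μ : Measure Ω}

theorem charFun_map_eq_integral_cexp {f : Ω → ℝ} (hf : AEMeasurable f μ) (t : ℝ) :
    charFun (μ.map f) t = ∫ ω, Complex.exp ((t * f ω : ℝ) * Complex.I) ∂μ := by
  rw [charFun_apply_real, integral_map hf (by fun_prop)]
  push_cast
  rfl

variable [IsProbabilityMeasure μ]

theorem integrable_cexp_mul_I {f : Ω → ℝ} (hf : AEMeasurable f μ) :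
    Integrable (fun ω => Complex.exp (f ω * Complex.I)) μ :=
  .of_bound (C := 1) (by fun_prop) (.of_forall fun ω => (Complex.norm_exp_ofReal_mul_I _).le)

theorem norm_charFun_map_sub_taylor_le {f : Ω → ℝ} (hf : MemLp f 3 μ)
    (hcentred : ∫ ω, f ω ∂μ = 0) (t : ℝ) :
    ‖charFun (μ.map f) t - ((1 - (∫ ω, f ω ^ 2 ∂μ) * t ^ 2 / 2 : ℝ) : ℂ)‖
      ≤ 4 * |t| ^ 3 * ∫ ω, |f ω| ^ 3 ∂μ := by
  have hf1 : Integrable f μ := hf.integrable (by norm_num)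
  have hf2 : Integrable (fun ω => f ω ^ 2) μ :=
    (hf.mono_exponent (by norm_num : (2 : ENNReal) ≤ 3)).integrable_sq
  have hf3 : Integrable (fun ω => |f ω| ^ 3) μ := by simpa using hf.integrable_norm_pow' (p := 3)
  have hlin : Integrable (fun ω => 1 + (t * Complex.I) * (f ω : ℂ)) μ :=
    (integrable_const _).add (hf1.ofReal.const_mul _)
  have hquad : Integrable (fun ω => ((t : ℂ) ^ 2 / 2) * ((f ω ^ 2 : ℝ) : ℂ)) μ :=
    hf2.ofReal.const_mul _
  have hpoly : ∀ ω, 1 + ((t * f ω : ℝ) : ℂ) * Complex.I - ((t * f ω : ℝ) : ℂ) ^ 2 / 2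
      = 1 + (t * Complex.I) * (f ω : ℂ) - ((t : ℂ) ^ 2 / 2) * ((f ω ^ 2 : ℝ) : ℂ) := fun ω => by
    push_cast
    ring
  have hmean : ∫ ω, (1 + ((t * f ω : ℝ) : ℂ) * Complex.I - ((t * f ω : ℝ) : ℂ) ^ 2 / 2) ∂μ
      = ((1 - (∫ ω, f ω ^ 2 ∂μ) * t ^ 2 / 2 : ℝ) : ℂ) := by
    simp_rw [hpoly]
    rw [integral_sub hlin hquad, integral_add (integrable_const _) (hf1.ofReal.const_mul _),
      integral_const_mul, integral_const_mul, integral_complex_ofReal, integral_complex_ofReal,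
      hcentred, integral_const, probReal_univ, one_smul]
    push_cast
    ring
  have hexp := integrable_cexp_mul_I (μ := μ) (hf1.aemeasurable.const_mul t)
  have htaylor := (hlin.sub hquad).congr (.of_forall fun ω => (hpoly ω).symm)
  rw [charFun_map_eq_integral_cexp hf1.aemeasurable, ← hmean, ← integral_sub hexp htaylor,
    ← integral_const_mul]
  refine (norm_integral_le_integral_norm _).trans
    (integral_mono (hexp.sub htaylor).norm (hf3.const_mul _) fun ω => ?_)
  simpa only [abs_mul, mul_pow, mul_assoc] using norm_cexp_mul_I_sub_taylor_le (t * f ω)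

theorem norm_charFun_map_sub_exp_le {f : Ω → ℝ} (hf : MemLp f 3 μ)
    (hcentred : ∫ ω, f ω ∂μ = 0) (t : ℝ) :
    ‖charFun (μ.map f) t - Real.exp (-((∫ ω, f ω ^ 2 ∂μ) * t ^ 2 / 2))‖
      ≤ 5 * |t| ^ 3 * ∫ ω, |f ω| ^ 3 ∂μ := by
  set σ := lpNorm f 2 μ
  have hσ : ∫ ω, f ω ^ 2 ∂μ = σ ^ 2 := integral_sq_eq_lpNorm_sq hf.aestronglyMeasurable
  have hσ3 : σ ^ 3 ≤ ∫ ω, |f ω| ^ 3 ∂μ := by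
    rw [integral_abs_cube_eq_lpNorm_cube hf.aestronglyMeasurable]
    exact pow_le_pow_left₀ lpNorm_nonneg (lpNorm_le_lpNorm_of_exponent_le (by norm_num) hf) 3
  set x := σ * t / √2
  have hx : (∫ ω, f ω ^ 2 ∂μ) * t ^ 2 / 2 = x ^ 2 := by
    rw [hσ, div_pow, mul_pow, Real.sq_sqrt zero_le_two]
  have hx3 : |x| ^ 3 ≤ |t| ^ 3 * ∫ ω, |f ω| ^ 3 ∂μ := by
    have hle : |x| ≤ |t| * σ := by
      rw [abs_div, abs_mul, abs_of_nonneg (lpNorm_nonneg : 0 ≤ σ), mul_comm σ]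
      rw [abs_of_nonneg (Real.sqrt_nonneg 2)]
      exact div_le_self (mul_nonneg (abs_nonneg t) lpNorm_nonneg) (Real.one_le_sqrt.2 one_le_two)
    calc |x| ^ 3 ≤ (|t| * σ) ^ 3 := by gcongr
      _ = |t| ^ 3 * σ ^ 3 := mul_pow _ _ _
      _ ≤ |t| ^ 3 * ∫ ω, |f ω| ^ 3 ∂μ := by gcongr
  have hexp : ‖((1 - x ^ 2 : ℝ) : ℂ) - Real.exp (-x ^ 2)‖ ≤ |x| ^ 3 := by
    rw [← Complex.ofReal_sub, Complex.norm_real]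
    exact abs_one_sub_sq_sub_exp_neg_sq_le x
  have htaylor := norm_charFun_map_sub_taylor_le hf hcentred t
  rw [hx] at htaylor ⊢
  linarith [norm_sub_le_norm_sub_add_norm_sub (charFun (μ.map f) t) ((1 - x ^ 2 : ℝ) : ℂ)
    (Real.exp (-x ^ 2) : ℂ)]

theorem norm_charFun_map_sum_sub_exp_le {ι : Type*} [Fintype ι] {f : ι → Ω → ℝ}
    (hf : ∀ i, MemLp (f i) 3 μ) (hindep : iIndepFun f μ)
    (hcentred : ∀ i, ∫ ω, f i ω ∂μ = 0) (t : ℝ) :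
    ‖charFun (μ.map fun ω => ∑ i, f i ω) t
        - Real.exp (-((∑ i, ∫ ω, f i ω ^ 2 ∂μ) * t ^ 2 / 2))‖
      ≤ 5 * |t| ^ 3 * ∑ i, ∫ ω, |f i ω| ^ 3 ∂μ := by
  have hmeas : ∀ i, AEMeasurable (f i) μ := fun i => (hf i).aestronglyMeasurable.aemeasurable
  have hexp : Real.exp (-((∑ i, ∫ ω, f i ω ^ 2 ∂μ) * t ^ 2 / 2))
      = ∏ i, Real.exp (-((∫ ω, f i ω ^ 2 ∂μ) * t ^ 2 / 2)) := by
    rw [← Real.exp_sum, Finset.sum_neg_distrib, Finset.sum_mul, Finset.sum_div]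
  rw [hindep.charFun_map_fun_sum_eq_prod hmeas, Finset.prod_apply, hexp, Complex.ofReal_prod,
    Finset.mul_sum]
  refine (norm_prod_sub_prod_le_sum _ _ _ (fun i => ?_) fun i => ?_).trans
    (Finset.sum_le_sum fun i _ => norm_charFun_map_sub_exp_le (hf i) (hcentred i) t)
  · have := Measure.isProbabilityMeasure_map (hmeas i)
    exact norm_charFun_le_one t
  · rw [Complex.norm_real, Real.norm_of_nonneg (Real.exp_pos _).le, Real.exp_le_one_iff,
      Left.neg_nonpos_iff]
    positivity

theorem norm_charFun_map_add_sub_le {f g : Ω → ℝ} (hf : AEMeasurable f μ)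
    (hg : MemLp g 2 μ) (t : ℝ) :
    ‖charFun (μ.map fun ω => f ω + g ω) t - charFun (μ.map f) t‖ ≤ |t| * lpNorm g 2 μ := by
  have hg1 : Integrable g μ := hg.integrable (by norm_num)
  have hfg : AEMeasurable (fun ω => f ω + g ω) μ := hf.add hg1.aemeasurable
  have hint := integrable_cexp_mul_I (μ := μ) (hf.const_mul t)
  have hint' := integrable_cexp_mul_I (μ := μ) (hfg.const_mul t)
  rw [charFun_map_eq_integral_cexp hfg, charFun_map_eq_integral_cexp hf, ← integral_sub hint' hint]
  have hpointwise : ∀ ω, ‖Complex.exp ((t * (f ω + g ω) : ℝ) * Complex.I)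
      - Complex.exp ((t * f ω : ℝ) * Complex.I)‖ ≤ |t| * |g ω| := fun ω => by
    have hfactor : Complex.exp ((t * (f ω + g ω) : ℝ) * Complex.I)
        - Complex.exp ((t * f ω : ℝ) * Complex.I) = Complex.exp ((t * f ω : ℝ) * Complex.I)
          * (Complex.exp (Complex.I * (t * g ω : ℝ)) - 1) := by
      rw [mul_sub, ← Complex.exp_add]
      push_cast
      ring_nf
    rw [hfactor, norm_mul, Complex.norm_exp_ofReal_mul_I, one_mul, ← abs_mul]
    exact Real.norm_exp_I_mul_ofReal_sub_one_le
  calc _ ≤ ∫ ω, |t| * |g ω| ∂μ := (norm_integral_le_integral_norm _).trans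
        (integral_mono (hint'.sub hint).norm (hg1.abs.const_mul _) hpointwise)
    _ = |t| * lpNorm g 1 μ := by
        rw [integral_const_mul, lpNorm_one_eq_integral_norm hg.aestronglyMeasurable]; rfl
    _ ≤ |t| * lpNorm g 2 μ := by
        gcongr
        exact lpNorm_le_lpNorm_of_exponent_le (by norm_num) hg

end CharacteristicFunction

section LinearPlusRemainder

section Fixed

variable {Ω ι : Type*} [MeasurableSpace Ω] {μ : Measure Ω} [Fintype ι]
  {ξ : ι → Ω → ℝ} {D : Ω → ℝ}

theorem variance_sum_eq_sum_integral_sq (hξ : ∀ i, MemLp (ξ i) 2 μ) (hindep : iIndepFun ξ μ)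
    (hcentred : ∀ i, ∫ ω, ξ i ω ∂μ = 0) :
    Var[fun ω => ∑ i, ξ i ω; μ] = ∑ i, ∫ ω, ξ i ω ^ 2 ∂μ := by
  have hvar := IndepFun.variance_sum (s := Finset.univ) (fun i _ => hξ i)
    fun i _ j _ hij => hindep.indepFun hij
  rw [Finset.sum_fn] at hvar
  rw [hvar]
  exact Finset.sum_congr rfl fun i _ =>
    variance_of_integral_eq_zero (hξ i).aestronglyMeasurable.aemeasurable (hcentred i)

variable [IsProbabilityMeasure μ]

theorem norm_charFun_map_sum_add_sub_exp_le (hξ : ∀ i, MemLp (ξ i) 3 μ) (hindep : iIndepFun ξ μ)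
    (hcentred : ∀ i, ∫ ω, ξ i ω ∂μ = 0) (hD : MemLp D 2 μ) (t : ℝ) :
    ‖charFun (μ.map fun ω => ∑ i, ξ i ω + D ω) t
        - Real.exp (-(Var[fun ω => ∑ i, ξ i ω; μ] * t ^ 2 / 2))‖
      ≤ |t| * lpNorm D 2 μ + 5 * |t| ^ 3 * ∑ i, ∫ ω, |ξ i ω| ^ 3 ∂μ := by
  have hξ2 : ∀ i, MemLp (ξ i) 2 μ := fun i => (hξ i).mono_exponent (by norm_num)
  have hsum : AEMeasurable (fun ω => ∑ i, ξ i ω) μ :=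
    (memLp_finsetSum Finset.univ fun i _ => hξ2 i).aestronglyMeasurable.aemeasurable
  have hlyapunov := norm_charFun_map_sum_sub_exp_le hξ hindep hcentred t
  rw [← variance_sum_eq_sum_integral_sq hξ2 hindep hcentred] at hlyapunov
  exact (norm_sub_le_norm_sub_add_norm_sub _ _ _).trans
    (add_le_add (norm_charFun_map_add_sub_le hsum hD t) hlyapunov)

theorem norm_charFun_map_standardized_sub_exp_le (hξ : ∀ i, MemLp (ξ i) 3 μ)
    (hindep : iIndepFun ξ μ) (hcentred : ∀ i, ∫ ω, ξ i ω ∂μ = 0) (hD : MemLp D 2 μ) {v V : ℝ}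
    (hV : V = Var[fun ω => ∑ i, ξ i ω; μ]) (hpos : 0 < V) (hle : V ≤ v) (t : ℝ) :
    ‖charFun (μ.map fun ω => v ^ (-(1 / 2) : ℝ) * (∑ i, ξ i ω + D ω)) t
        - Real.exp (-((v / V)⁻¹ * t ^ 2 / 2))‖
      ≤ |t| * √((∫ ω, D ω ^ 2 ∂μ) / V)
        + 5 * |t| ^ 3 * (V ^ (-(3 / 2) : ℝ) * ∑ i, ∫ ω, |ξ i ω| ^ 3 ∂μ) := by
  have hmeas : AEMeasurable (fun ω => ∑ i, ξ i ω + D ω) μ :=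
    ((memLp_finsetSum Finset.univ fun i _ => hξ i).aestronglyMeasurable.add
      hD.aestronglyMeasurable).aemeasurable
  set s := v ^ (-(1 / 2) : ℝ)
  have hs : s = (√v)⁻¹ := by rw [Real.sqrt_eq_rpow, ← Real.rpow_neg (hpos.le.trans hle)]
  have hs0 : 0 ≤ s := hs ▸ by positivity
  have hsV : s ≤ (√V)⁻¹ := hs ▸ inv_anti₀ (Real.sqrt_pos.2 hpos) (Real.sqrt_le_sqrt hle)
  have hV3 : V ^ (-(3 / 2) : ℝ) = (√V)⁻¹ ^ 3 := by
    rw [Real.sqrt_eq_rpow, ← Real.rpow_neg hpos.le, ← Real.rpow_natCast, ← Real.rpow_mul hpos.le]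
    norm_num
  have hexponent : (v / V)⁻¹ * t ^ 2 / 2 = V * (s * t) ^ 2 / 2 := by
    rw [inv_div, mul_pow, hs, inv_pow, Real.sq_sqrt (hpos.le.trans hle)]
    ring
  have hremainder : √((∫ ω, D ω ^ 2 ∂μ) / V) = (√V)⁻¹ * lpNorm D 2 μ := by
    rw [integral_sq_eq_lpNorm_sq hD.aestronglyMeasurable, Real.sqrt_div (sq_nonneg _),
      Real.sqrt_sq lpNorm_nonneg, div_eq_inv_mul]
  rw [charFun_map_mul_comp hmeas, hexponent, hV]
  refine (norm_charFun_map_sum_add_sub_exp_le hξ hindep hcentred hD (s * t)).trans ?_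
  rw [← hV, hremainder, hV3, abs_mul, abs_of_nonneg hs0, mul_pow]
  have hlinear := mul_le_mul_of_nonneg_right hsV
    (mul_nonneg (abs_nonneg t) (lpNorm_nonneg (f := D) (p := 2) (μ := μ)))
  have hcubic := mul_le_mul_of_nonneg_right (pow_le_pow_left₀ hs0 hsV 3)
    (show 0 ≤ 5 * |t| ^ 3 * ∑ i, ∫ ω, |ξ i ω| ^ 3 ∂μ by positivity)
  linarith

end Fixed

theorem tendstoInDistribution_standardized_sum_add {Ω : ℕ → Type*} [∀ n, MeasurableSpace (Ω n)]
    {μ : (n : ℕ) → Measure (Ω n)} [∀ n, IsProbabilityMeasure (μ n)]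
    {ι : ℕ → Type*} [∀ n, Fintype (ι n)] {ξ : (n : ℕ) → ι n → Ω n → ℝ} {D : (n : ℕ) → Ω n → ℝ}
    (hξ : ∀ n i, MemLp (ξ n i) 3 (μ n)) (hindep : ∀ n, iIndepFun (ξ n) (μ n))
    (hcentred : ∀ n i, ∫ ω, ξ n i ω ∂(μ n) = 0) (hD : ∀ n, MemLp (D n) 2 (μ n))
    {v V : ℕ → ℝ} (hV : ∀ n, V n = Var[fun ω => ∑ i, ξ n i ω; μ n])
    (hpos : ∀ᶠ n in atTop, 0 < V n) (hle : ∀ n, V n ≤ v n)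
    (hratio : Tendsto (fun n => v n / V n) atTop (𝓝 1))
    (hsmall : Tendsto (fun n => (∫ ω, D n ω ^ 2 ∂(μ n)) / V n) atTop (𝓝 0))
    (hlyapunov : Tendsto (fun n => V n ^ (-(3 / 2) : ℝ) * ∑ i, ∫ ω, |ξ n i ω| ^ 3 ∂(μ n))
      atTop (𝓝 0)) :
    TendstoInDistribution (fun n ω => v n ^ (-(1 / 2) : ℝ) * (∑ i, ξ n i ω + D n ω))
      atTop (id : ℝ → ℝ) μ (gaussianReal 0 1) := by
  have hmeas : ∀ n, AEMeasurable (fun ω => ∑ i, ξ n i ω + D n ω) (μ n) := fun n =>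
    ((memLp_finsetSum Finset.univ fun i _ => hξ n i).aestronglyMeasurable.add
      (hD n).aestronglyMeasurable).aemeasurable
  refine ⟨fun n => (hmeas n).const_mul _, aemeasurable_id,
    ProbabilityMeasure.tendsto_of_tendsto_charFun fun t => ?_⟩
  simp only [ProbabilityMeasure.coe_mk, Measure.map_id]
  have hgauss : Tendsto (fun n => (Real.exp (-((v n / V n)⁻¹ * t ^ 2 / 2)) : ℂ)) atTop
      (𝓝 (charFun (gaussianReal 0 1) t)) := by
    have hlimit : charFun (gaussianReal 0 1) t = (Real.exp (-((1 : ℝ)⁻¹ * t ^ 2 / 2)) : ℂ) := by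
      rw [charFun_gaussianReal]
      simp
    rw [hlimit]
    exact (Complex.continuous_ofReal.tendsto _).comp <| (Real.continuous_exp.tendsto _).comp
      ((((hratio.inv₀ one_ne_zero).mul_const (t ^ 2)).div_const 2).neg)
  have hbound := (hsmall.sqrt.const_mul |t|).add (hlyapunov.const_mul (5 * |t| ^ 3))
  rw [Real.sqrt_zero, mul_zero, mul_zero, add_zero] at hbound
  have hdiff := squeeze_zero_norm' (hpos.mono fun n hn => norm_charFun_map_standardized_sub_exp_le
    (hξ n) (hindep n) (hcentred n) (hD n) (hV n) hn (hle n) t) hbound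
  simpa using hdiff.add hgauss

end LinearPlusRemainder

section ProductSpace

theorem eLpNorm_integral_prod_right_le {α β : Type*} [MeasurableSpace α] [MeasurableSpace β]
    {μ : Measure α} {ν : Measure β} [SFinite μ] [IsProbabilityMeasure ν] {f : α × β → ℝ}
    {p : ENNReal} (hp : 1 ≤ p) (hp' : p ≠ ⊤) (hf : AEStronglyMeasurable f (μ.prod ν)) :
    eLpNorm (fun x => ∫ y, f (x, y) ∂ν) p μ ≤ eLpNorm f p (μ.prod ν) := by
  lift p to NNReal using hp'
  have hp0 : p ≠ 0 := (zero_lt_one.trans_le (by exact_mod_cast hp)).ne'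
  have hjensen : ∀ᵐ x ∂μ, ‖∫ y, f (x, y) ∂ν‖ₑ ^ (p : ℝ) ≤ ∫⁻ y, ‖f (x, y)‖ₑ ^ (p : ℝ) ∂ν := by
    filter_upwards [hf.prodMk_left] with x hx
    rw [← eLpNorm_nnreal_pow_eq_lintegral hp0]
    gcongr
    calc ‖∫ y, f (x, y) ∂ν‖ₑ ≤ ∫⁻ y, ‖f (x, y)‖ₑ ∂ν := enorm_integral_le_lintegral_enorm _
      _ = eLpNorm (fun y => f (x, y)) 1 ν := eLpNorm_one_eq_lintegral_enorm.symm
      _ ≤ eLpNorm (fun y => f (x, y)) p ν := eLpNorm_le_eLpNorm_of_exponent_le hp hx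
  rw [← ENNReal.rpow_le_rpow_iff (z := (p : ℝ)) (by positivity),
    eLpNorm_nnreal_pow_eq_lintegral hp0, eLpNorm_nnreal_pow_eq_lintegral hp0,
    lintegral_prod _ (hf.enorm.pow_const _)]
  exact lintegral_mono_ae hjensen

variable {ι : Type*} [Fintype ι] [DecidableEq ι] {𝓧 : ι → Type*} [∀ i, MeasurableSpace (𝓧 i)]
  {P : ∀ i, Measure (𝓧 i)}

/-- `E{F(X) | X_i, i ∈ S}` as a function of the sample, for independent `X_i` with laws `P i`. -/
noncomputable def marginal (P : ∀ i, Measure (𝓧 i)) (S : Finset ι) (F : (∀ i, 𝓧 i) → ℝ)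
    (x : ∀ i, 𝓧 i) : ℝ :=
  ∫ y, F (S.piecewise x y) ∂Measure.pi P

/-- The part of the Hoeffding decomposition of `F` that involves the coordinate `i` only. -/
noncomputable def mainEffect (P : ∀ i, Measure (𝓧 i)) (i : ι) (F : (∀ i, 𝓧 i) → ℝ)
    (x : ∀ i, 𝓧 i) : ℝ :=
  marginal P {i} F x - ∫ y, F y ∂Measure.pi P

/-- The remainder of `F` after its Hájek projection: the sum of all terms of the Hoeffding
decomposition that involve at least two coordinates. -/
noncomputable def hajekResidual (P : ∀ i, Measure (𝓧 i)) (F : (∀ i, 𝓧 i) → ℝ)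
    (x : ∀ i, 𝓧 i) : ℝ :=
  F x - ∫ y, F y ∂Measure.pi P - ∑ i, mainEffect P i F x

variable {S T : Finset ι} {F G : (∀ i, 𝓧 i) → ℝ} {i : ι}

theorem sub_integral_eq_sum_mainEffect_add (x : ∀ i, 𝓧 i) :
    F x - ∫ y, F y ∂Measure.pi P = ∑ i, mainEffect P i F x + hajekResidual P F x := by
  rw [hajekResidual, add_sub_cancel]

theorem marginal_empty (x : ∀ i, 𝓧 i) : marginal P ∅ F x = ∫ y, F y ∂Measure.pi P := by
  simp only [marginal, Finset.piecewise_empty]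

theorem dependsOn_marginal : DependsOn (marginal P S F) (S : Set ι) := fun x x' hx => by
  have hpiecewise (y : ∀ i, 𝓧 i) : S.piecewise x y = S.piecewise x' y :=
    S.piecewise_congr hx fun _ _ => rfl
  simp only [marginal, hpiecewise]

theorem marginal_eq_marginal_inter (hF : DependsOn F (T : Set ι)) :
    marginal P S F = marginal P (S ∩ T) F := by
  funext x
  refine integral_congr_ae (.of_forall fun y => hF fun j hj => ?_)
  by_cases hjS : j ∈ S <;> simp_all [Finset.piecewise]

theorem dependsOn_mainEffect : DependsOn (mainEffect P i F) ({i} : Set ι) := fun x x' hx => by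
  have hmarginal : marginal P {i} F x = marginal P {i} F x' :=
    dependsOn_marginal (by simpa using hx)
  simp only [mainEffect, hmarginal]

theorem mainEffect_eq_zero_of_notMem (hF : DependsOn F (T : Set ι)) (hi : i ∉ T) :
    mainEffect P i F = 0 := by
  funext x
  rw [mainEffect, marginal_eq_marginal_inter hF, Finset.singleton_inter_of_notMem hi,
    marginal_empty, sub_self, Pi.zero_apply]

theorem hajekResidual_eq_of_dependsOn (hF : DependsOn F (T : Set ι)) (x : ∀ i, 𝓧 i) :
    hajekResidual P F x = F x - ∫ y, F y ∂Measure.pi P - ∑ i ∈ T, mainEffect P i F x := by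
  rw [hajekResidual, Finset.sum_subset T.subset_univ fun i _ hi => by
    rw [mainEffect_eq_zero_of_notMem hF hi, Pi.zero_apply]]

theorem dependsOn_hajekResidual (hF : DependsOn F (T : Set ι)) :
    DependsOn (hajekResidual P F) (T : Set ι) := fun x x' hx => by
  rw [hajekResidual_eq_of_dependsOn hF, hajekResidual_eq_of_dependsOn hF, hF hx]
  congr 1
  exact Finset.sum_congr rfl fun i hi => dependsOn_mainEffect fun j hj => by
    rw [Set.mem_singleton_iff.1 hj, hx i hi]

variable [∀ i, IsProbabilityMeasure (P i)]

theorem measurePreserving_piecewise (S : Finset ι) :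
    MeasurePreserving (fun z : (∀ i, 𝓧 i) × (∀ i, 𝓧 i) => S.piecewise z.1 z.2)
      ((Measure.pi P).prod (Measure.pi P)) (Measure.pi P) := by
  have hmeas : Measurable fun z : (∀ i, 𝓧 i) × (∀ i, 𝓧 i) => S.piecewise z.1 z.2 :=
    measurable_pi_lambda _ fun i => by
      by_cases hi : i ∈ S <;> simp only [Finset.piecewise, hi, if_true, if_false] <;> fun_prop
  refine ⟨hmeas, (Measure.pi_eq fun s hs => ?_).symm⟩
  have hpreimage : (fun z : (∀ i, 𝓧 i) × (∀ i, 𝓧 i) => S.piecewise z.1 z.2) ⁻¹' Set.univ.pi s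
      = (Set.univ.pi (S.piecewise s fun _ => Set.univ))
        ×ˢ Set.univ.pi (S.piecewise (fun _ => Set.univ) s) := by
    ext z
    simp only [Set.mem_preimage, Set.mem_prod, Set.mem_univ_pi, ← forall_and]
    refine forall_congr' fun i => ?_
    by_cases hi : i ∈ S <;> simp [Finset.piecewise, hi]
  rw [Measure.map_apply hmeas (.univ_pi hs), hpreimage, Measure.prod_prod, Measure.pi_pi,
    Measure.pi_pi, ← Finset.prod_mul_distrib]
  refine Finset.prod_congr rfl fun i _ => ?_
  by_cases hi : i ∈ S <;> simp [Finset.piecewise, hi]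

theorem integral_mul_eq_integral_marginal_mul (hG : DependsOn G (S : Set ι))
    (hFG : Integrable (fun x => F x * G x) (Measure.pi P)) :
    ∫ x, F x * G x ∂Measure.pi P = ∫ x, marginal P S F x * G x ∂Measure.pi P := by
  have hpw := measurePreserving_piecewise (P := P) S
  have hG_piecewise (x y : ∀ i, 𝓧 i) : G (S.piecewise x y) = G x :=
    hG fun i hi => S.piecewise_eq_of_mem x y hi
  have hprod : Integrable (fun z : (∀ i, 𝓧 i) × (∀ i, 𝓧 i) => F (S.piecewise z.1 z.2) * G z.1)
      ((Measure.pi P).prod (Measure.pi P)) := by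
    simpa only [Function.comp_def, hG_piecewise] using hpw.integrable_comp_of_integrable hFG
  calc ∫ x, F x * G x ∂Measure.pi P
      = ∫ z : (∀ i, 𝓧 i) × (∀ i, 𝓧 i), F (S.piecewise z.1 z.2) * G z.1
          ∂(Measure.pi P).prod (Measure.pi P) := by
        rw [← hpw.map_eq] at hFG
        conv_lhs => rw [← hpw.map_eq, integral_map hpw.aemeasurable hFG.aestronglyMeasurable]
        simp only [hG_piecewise]
    _ = ∫ x, marginal P S F x * G x ∂Measure.pi P := by
        simp only [integral_prod _ hprod, integral_mul_const, marginal]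

theorem memLp_marginal {p : ENNReal} (hp : 1 ≤ p) (hp' : p ≠ ⊤) (hF : MemLp F p (Measure.pi P)) :
    MemLp (marginal P S F) p (Measure.pi P) := by
  have hpw := hF.comp_measurePreserving (measurePreserving_piecewise (P := P) S)
  refine ⟨AEStronglyMeasurable.integral_prod_right' hpw.aestronglyMeasurable, ?_⟩
  exact (eLpNorm_integral_prod_right_le hp hp' hpw.aestronglyMeasurable).trans_lt hpw.eLpNorm_lt_top

theorem lpNorm_marginal_le {p : ENNReal} (hp : 1 ≤ p) (hp' : p ≠ ⊤)
    (hF : MemLp F p (Measure.pi P)) :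
    lpNorm (marginal P S F) p (Measure.pi P) ≤ lpNorm F p (Measure.pi P) := by
  have hpw := measurePreserving_piecewise (P := P) S
  have hcontract := eLpNorm_integral_prod_right_le hp hp'
    (hF.comp_measurePreserving hpw).aestronglyMeasurable
  rw [eLpNorm_comp_measurePreserving hF.aestronglyMeasurable hpw] at hcontract
  rw [← toReal_eLpNorm (memLp_marginal hp hp' hF).aestronglyMeasurable,
    ← toReal_eLpNorm hF.aestronglyMeasurable]
  exact ENNReal.toReal_mono hF.eLpNorm_ne_top hcontract

theorem memLp_mainEffect {p : ENNReal} (hp : 1 ≤ p) (hp' : p ≠ ⊤)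
    (hF : MemLp F p (Measure.pi P)) : MemLp (mainEffect P i F) p (Measure.pi P) :=
  (memLp_marginal hp hp' hF).sub (memLp_const _)

theorem lpNorm_mainEffect_le {p : ENNReal} (hp : 1 ≤ p) (hp' : p ≠ ⊤)
    (hF : MemLp F p (Measure.pi P)) :
    lpNorm (mainEffect P i F) p (Measure.pi P) ≤ 2 * lpNorm F p (Measure.pi P) := by
  calc lpNorm (mainEffect P i F) p (Measure.pi P)
      ≤ lpNorm (marginal P {i} F) p (Measure.pi P)
        + lpNorm (fun _ => ∫ y, F y ∂Measure.pi P) p (Measure.pi P) :=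
        lpNorm_sub_le (memLp_marginal hp hp' hF) hp
    _ ≤ lpNorm F p (Measure.pi P) + lpNorm F p (Measure.pi P) := by
        gcongr
        · exact lpNorm_marginal_le hp hp' hF
        · exact lpNorm_integral_le hp hF
    _ = 2 * lpNorm F p (Measure.pi P) := (two_mul _).symm

theorem integral_mainEffect_mul (hF : MemLp F 2 (Measure.pi P)) (hG : MemLp G 2 (Measure.pi P)) :
    ∫ x, mainEffect P i F x * G x ∂Measure.pi P
      = ∫ x, marginal P {i} F x * G x ∂Measure.pi P
        - (∫ x, F x ∂Measure.pi P) * ∫ x, G x ∂Measure.pi P := by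
  have hmarginal : Integrable (fun x => marginal P {i} F x * G x) (Measure.pi P) :=
    (memLp_marginal one_le_two (by simp) hF).integrable_mul hG
  simp only [mainEffect, sub_mul]
  rw [integral_sub hmarginal ((hG.integrable one_le_two).const_mul _), integral_const_mul]

omit [DecidableEq ι] in
theorem integral_mul_eq_of_disjoint (hF : DependsOn F (T : Set ι)) (hG : DependsOn G (S : Set ι))
    (hF2 : MemLp F 2 (Measure.pi P)) (hG2 : MemLp G 2 (Measure.pi P)) (hST : Disjoint S T) :
    ∫ x, F x * G x ∂Measure.pi P
      = (∫ x, F x ∂Measure.pi P) * ∫ x, G x ∂Measure.pi P := by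
  classical
  rw [integral_mul_eq_integral_marginal_mul hG (hF2.integrable_mul hG2),
    marginal_eq_marginal_inter hF, Finset.disjoint_iff_inter_eq_empty.1 hST]
  simp only [marginal_empty, integral_const_mul]

theorem integral_mainEffect (hF : Integrable F (Measure.pi P)) :
    ∫ x, mainEffect P i F x ∂Measure.pi P = 0 := by
  have hF1 := memLp_one_iff_integrable.2 hF
  have hmean := integral_mul_eq_integral_marginal_mul (P := P) (F := F) (S := {i})
    (G := fun _ => 1) (fun _ _ _ => rfl) (by simpa using hF)
  simp only [mul_one] at hmean
  simp only [mainEffect]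
  rw [integral_sub ((memLp_marginal le_rfl (by simp) hF1).integrable le_rfl)
    (integrable_const _), ← hmean]
  simp

theorem integral_mainEffect_mul_eq_zero (hG : DependsOn G (S : Set ι)) (hi : i ∉ S)
    (hF2 : MemLp F 2 (Measure.pi P)) (hG2 : MemLp G 2 (Measure.pi P)) :
    ∫ x, mainEffect P i F x * G x ∂Measure.pi P = 0 := by
  rw [integral_mul_eq_of_disjoint (T := {i}) (by simpa using dependsOn_mainEffect) hG
      (memLp_mainEffect one_le_two (by simp) hF2) hG2 (Finset.disjoint_singleton_right.2 hi),
    integral_mainEffect (hF2.integrable one_le_two), zero_mul]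

theorem integral_hajekResidual_mul (hF : MemLp F 2 (Measure.pi P))
    (hG : MemLp G 2 (Measure.pi P)) :
    ∫ x, hajekResidual P F x * G x ∂Measure.pi P
      = ∫ x, F x * G x ∂Measure.pi P - (∫ x, F x ∂Measure.pi P) * ∫ x, G x ∂Measure.pi P
        - ∑ i, ∫ x, mainEffect P i F x * G x ∂Measure.pi P := by
  have hFG : Integrable (fun x => F x * G x) (Measure.pi P) := hF.integrable_mul hG
  have hmean : Integrable (fun x => (∫ y, F y ∂Measure.pi P) * G x) (Measure.pi P) :=
    (hG.integrable one_le_two).const_mul _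
  have heffect (i : ι) : Integrable (fun x => mainEffect P i F x * G x) (Measure.pi P) :=
    (memLp_mainEffect one_le_two (by simp) hF).integrable_mul hG
  have hcentred : Integrable (fun x => F x * G x - (∫ y, F y ∂Measure.pi P) * G x)
      (Measure.pi P) := hFG.sub hmean
  simp only [hajekResidual, sub_mul, Finset.sum_mul]
  rw [integral_sub hcentred (integrable_finsetSum _ fun i _ => heffect i),
    integral_sub hFG hmean, integral_const_mul, integral_finsetSum _ fun i _ => heffect i]

theorem integral_hajekResidual_mul_eq_zero (hF : DependsOn F (T : Set ι))
    (hG : DependsOn G (S : Set ι)) (hST : (S ∩ T).card ≤ 1)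
    (hF2 : MemLp F 2 (Measure.pi P)) (hG2 : MemLp G 2 (Measure.pi P)) :
    ∫ x, hajekResidual P F x * G x ∂Measure.pi P = 0 := by
  have hvanish (i : ι) (hi : i ∉ S ∩ T) : ∫ x, mainEffect P i F x * G x ∂Measure.pi P = 0 := by
    by_cases hiS : i ∈ S
    · have hiT : i ∉ T := fun hiT => hi (Finset.mem_inter.2 ⟨hiS, hiT⟩)
      simp [mainEffect_eq_zero_of_notMem hF hiT]
    · exact integral_mainEffect_mul_eq_zero hG hiS hF2 hG2
  rw [integral_hajekResidual_mul hF2 hG2,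
    ← Finset.sum_subset (S ∩ T).subset_univ fun i _ hi => hvanish i hi]
  rcases Nat.le_one_iff_eq_zero_or_eq_one.1 hST with hcard | hcard
  · rw [Finset.card_eq_zero] at hcard
    rw [integral_mul_eq_of_disjoint hF hG hF2 hG2 (Finset.disjoint_iff_inter_eq_empty.2 hcard),
      hcard, Finset.sum_empty, sub_self, sub_zero]
  · obtain ⟨i, hi⟩ := Finset.card_eq_one.1 hcard
    rw [hi, Finset.sum_singleton, integral_mainEffect_mul hF2 hG2,
      integral_mul_eq_integral_marginal_mul hG (hF2.integrable_mul hG2),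
      marginal_eq_marginal_inter hF, hi, sub_self]

theorem memLp_hajekResidual {p : ENNReal} (hp : 1 ≤ p) (hp' : p ≠ ⊤)
    (hF : MemLp F p (Measure.pi P)) : MemLp (hajekResidual P F) p (Measure.pi P) :=
  (hF.sub (memLp_const _)).sub (memLp_finsetSum _ fun _ _ => memLp_mainEffect hp hp' hF)

theorem lpNorm_hajekResidual_le {p : ENNReal} (hp : 1 ≤ p) (hp' : p ≠ ⊤)
    (hF : DependsOn F (T : Set ι)) (hFp : MemLp F p (Measure.pi P)) :
    lpNorm (hajekResidual P F) p (Measure.pi P)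
      ≤ 2 * (1 + T.card) * lpNorm F p (Measure.pi P) := by
  have hmean : lpNorm (fun _ => ∫ y, F y ∂Measure.pi P) p (Measure.pi P)
      ≤ lpNorm F p (Measure.pi P) := lpNorm_integral_le hp hFp
  have heffects : lpNorm (∑ i ∈ T, mainEffect P i F) p (Measure.pi P)
      ≤ ∑ _i ∈ T, 2 * lpNorm F p (Measure.pi P) :=
    (lpNorm_sum_le (fun i _ => memLp_mainEffect hp hp' hFp) hp).trans
      (Finset.sum_le_sum fun i _ => lpNorm_mainEffect_le hp hp' hFp)
  have hdecomp : hajekResidual P F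
      = (F - fun _ => ∫ y, F y ∂Measure.pi P) - ∑ i ∈ T, mainEffect P i F := by
    funext x
    simp [hajekResidual_eq_of_dependsOn hF]
  have htriangle := (lpNorm_sub_le (g := ∑ i ∈ T, mainEffect P i F)
    (hFp.sub (memLp_const _)) hp).trans
    (add_le_add_left (lpNorm_sub_le (g := fun _ => ∫ y, F y ∂Measure.pi P) hFp hp) _)
  rw [hdecomp]
  rw [Finset.sum_const, nsmul_eq_mul] at heffects
  linarith

theorem measurable_mainEffect (hF : Measurable F) : Measurable (mainEffect P i F) := by
  have hF_piecewise : Measurable fun z : (∀ i, 𝓧 i) × (∀ i, 𝓧 i) =>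
      F (({i} : Finset ι).piecewise z.1 z.2) :=
    hF.comp (measurePreserving_piecewise (P := P) {i}).measurable
  exact (hF_piecewise.stronglyMeasurable.integral_prod_right'.measurable).sub_const _

omit [DecidableEq ι] in
theorem iIndepFun_of_dependsOn_singleton {f : ι → (∀ i, 𝓧 i) → ℝ} (hf : ∀ i, Measurable (f i))
    (hdep : ∀ i, DependsOn (f i) ({i} : Set ι)) : iIndepFun f (Measure.pi P) := by
  classical
  obtain ⟨x₀⟩ : Nonempty (∀ i, 𝓧 i) := (Measure.pi P).nonempty_of_neZero
  have hcoord (i : ι) (x : ∀ i, 𝓧 i) : f i (Function.update x₀ i (x i)) = f i x :=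
    hdep i fun j hj => by rw [Set.mem_singleton_iff.1 hj, Function.update_self]
  have hindep := iIndepFun_pi (μ := P) (X := fun i v => f i (Function.update x₀ i v))
    fun i => ((hf i).comp (measurable_update x₀)).aemeasurable
  simpa only [hcoord] using hindep

theorem covariance_sum_mainEffect_hajekResidual (hF : MemLp F 2 (Measure.pi P)) :
    cov[fun x => ∑ i, mainEffect P i F x, hajekResidual P F; Measure.pi P] = 0 := by
  have heffect (i : ι) : MemLp (mainEffect P i F) 2 (Measure.pi P) :=
    memLp_mainEffect one_le_two (by simp) hF
  have hresidual := memLp_hajekResidual one_le_two (by simp) hF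
  rw [covariance_fun_sum_left heffect hresidual]
  refine Finset.sum_eq_zero fun i _ => ?_
  have horth : ∫ x, hajekResidual P F x * mainEffect P i F x ∂Measure.pi P = 0 :=
    integral_hajekResidual_mul_eq_zero (T := Finset.univ) (S := {i})
      (fun x x' hx => by rw [funext fun j => hx j (by simp)])
      (by simpa using dependsOn_mainEffect) (by simp) hF (heffect i)
  rw [covariance_comm, covariance_eq_sub hresidual (heffect i),
    integral_mainEffect (hF.integrable one_le_two), mul_zero, sub_zero]
  exact horth

theorem integral_hajekResidual (hF : MemLp F 2 (Measure.pi P)) :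
    ∫ x, hajekResidual P F x ∂Measure.pi P = 0 := by
  simpa using integral_hajekResidual_mul_eq_zero (T := Finset.univ) (S := ∅) (G := fun _ => 1)
    (fun x x' hx => by rw [funext fun j => hx j (by simp)]) (fun _ _ _ => rfl) (by simp) hF
    (memLp_const 1)

theorem variance_eq_variance_sum_mainEffect_add (hF : MemLp F 2 (Measure.pi P)) :
    Var[F; Measure.pi P] = Var[fun x => ∑ i, mainEffect P i F x; Measure.pi P]
      + ∫ x, hajekResidual P F x ^ 2 ∂Measure.pi P := by
  have hlinear : MemLp (fun x => ∑ i, mainEffect P i F x) 2 (Measure.pi P) :=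
    memLp_finsetSum _ fun i _ => memLp_mainEffect one_le_two (by simp) hF
  have hresidual := memLp_hajekResidual one_le_two (by simp) hF
  rw [← variance_of_integral_eq_zero hresidual.aestronglyMeasurable.aemeasurable
    (integral_hajekResidual hF), ← variance_sub_const hF.aestronglyMeasurable
    (∫ y, F y ∂Measure.pi P)]
  simp only [sub_integral_eq_sum_mainEffect_add]
  rw [variance_fun_add hlinear hresidual, covariance_sum_mainEffect_hajekResidual hF, mul_zero,
    add_zero]

/-- The `K`-tuples of terms `t ∈ τ` whose supports `T t` have at least `q` indices in common; with
`T t` the set of entries of `t`, this is `(I_n^m)_{≥ q}^{⊗ K}` for an arbitrary family. -/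
def sharingTuples {β : Type*} (τ : Finset β) (T : β → Finset ι) (K q : ℕ) : Finset (Fin K → β) :=
  (Fintype.piFinset fun _ => τ).filter fun p =>
    q ≤ (Finset.univ.filter fun i => ∀ k, i ∈ T (p k)).card

variable {β : Type*} {τ : Finset β} {T : β → Finset ι} {w : β → ℝ} {F : β → (∀ i, 𝓧 i) → ℝ}

theorem integral_sq_sum_hajekResidual_le {C : ℝ} (hF : ∀ t ∈ τ, DependsOn (F t) (T t : Set ι))
    (hF2 : ∀ t ∈ τ, MemLp (F t) 2 (Measure.pi P))
    (hC : ∀ t ∈ τ, lpNorm (hajekResidual P (F t)) 2 (Measure.pi P) ≤ C) :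
    ∫ x, (∑ t ∈ τ, w t * hajekResidual P (F t) x) ^ 2 ∂Measure.pi P
      ≤ C ^ 2 * ∑ p ∈ sharingTuples τ T 2 2, |∏ k, w (p k)| := by
  refine integral_pow_weighted_sum_le (K := 2) w _
    (fun t ht => memLp_hajekResidual one_le_two (by simp) (hF2 t ht)) hC fun p hp hcard => ?_
  have hinter : T (p 1) ∩ T (p 0) = Finset.univ.filter fun i => ∀ k, i ∈ T (p k) := by
    ext i
    simp [Fin.forall_fin_two, and_comm]
  simp only [Fin.prod_univ_two]
  exact integral_hajekResidual_mul_eq_zero (hF _ (hp 0)) (dependsOn_hajekResidual (hF _ (hp 1)))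
    (by rw [hinter]; omega) (hF2 _ (hp 0))
    (memLp_hajekResidual one_le_two (by simp) (hF2 _ (hp 1)))

theorem integral_abs_pow_sum_mainEffect_le {K : ℕ} [NeZero K] {C : ℝ}
    (hF : ∀ t ∈ τ, DependsOn (F t) (T t : Set ι))
    (hFK : ∀ t ∈ τ, MemLp (F t) K (Measure.pi P))
    (hC : ∀ t ∈ τ, lpNorm (mainEffect P i (F t)) K (Measure.pi P) ≤ C) :
    ∫ x, |∑ t ∈ τ, w t * mainEffect P i (F t) x| ^ K ∂Measure.pi P
      ≤ C ^ K * ∑ p ∈ Fintype.piFinset (fun _ : Fin K => τ) with ∀ k, i ∈ T (p k),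
          |∏ k, w (p k)| := by
  have hmem : ∀ t ∈ τ, MemLp (mainEffect P i (F t)) K (Measure.pi P) := fun t ht =>
    memLp_mainEffect (by exact_mod_cast NeZero.one_le) (by simp) (hFK t ht)
  have hvanish (p : Fin K → β) (hp : ∀ k, p k ∈ τ) (hi : ¬∀ k, i ∈ T (p k)) :
      ∫ x, ∏ k, |mainEffect P i (F (p k)) x| ∂Measure.pi P = 0 := by
    obtain ⟨k, hk⟩ := not_forall.1 hi
    have hzero (x : ∀ i, 𝓧 i) : ∏ k, |mainEffect P i (F (p k)) x| = 0 :=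
      Finset.prod_eq_zero (Finset.mem_univ k) <| by
        rw [mainEffect_eq_zero_of_notMem (hF _ (hp k)) hk, Pi.zero_apply, abs_zero]
    simp only [hzero, integral_zero]
  have hdom : MemLp (fun x => ∑ t ∈ τ, |w t| * |mainEffect P i (F t) x|) K (Measure.pi P) :=
    memLp_finsetSum _ fun t ht => (hmem t ht).abs.const_mul _
  have hnonneg (x : ∀ i, 𝓧 i) : 0 ≤ ∑ t ∈ τ, |w t| * |mainEffect P i (F t) x| :=
    Finset.sum_nonneg fun _ _ => by positivity
  calc ∫ x, |∑ t ∈ τ, w t * mainEffect P i (F t) x| ^ K ∂Measure.pi P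
      ≤ ∫ x, (∑ t ∈ τ, |w t| * |mainEffect P i (F t) x|) ^ K ∂Measure.pi P := by
        refine integral_mono_of_nonneg (.of_forall fun x => by positivity) ?_
          (.of_forall fun x => ?_)
        · simpa only [Real.norm_of_nonneg (hnonneg _)] using hdom.integrable_norm_pow (NeZero.ne K)
        · refine pow_le_pow_left₀ (abs_nonneg _) ((Finset.abs_sum_le_sum_abs _ _).trans_eq ?_) K
          simp only [abs_mul]
    _ ≤ C ^ K * ∑ p ∈ Fintype.piFinset (fun _ : Fin K => τ) with ∀ k, i ∈ T (p k),
          |∏ k, (|w (p k)|)| :=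
        integral_pow_weighted_sum_le (fun t => |w t|) _ (fun t ht => (hmem t ht).abs)
          (fun t ht => by rw [lpNorm_fun_abs (hmem t ht).aestronglyMeasurable]; exact hC t ht)
          hvanish
    _ = C ^ K * ∑ p ∈ Fintype.piFinset (fun _ : Fin K => τ) with ∀ k, i ∈ T (p k),
          |∏ k, w (p k)| := by simp only [← Finset.abs_prod, abs_abs]

theorem sum_sum_filter_forall_mem_le {K m : ℕ} [NeZero K] (hT : ∀ t ∈ τ, (T t).card ≤ m)
    (c : (Fin K → β) → ℝ) (hc : ∀ p, 0 ≤ c p) :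
    ∑ i, ∑ p ∈ Fintype.piFinset (fun _ : Fin K => τ) with ∀ k, i ∈ T (p k), c p
      ≤ m * ∑ p ∈ sharingTuples τ T K 1, c p := by
  have hcommon (p : Fin K → β) (hp : ∀ k, p k ∈ τ) :
      (Finset.univ.filter fun i => ∀ k, i ∈ T (p k)).card ≤ m :=
    (Finset.card_le_card fun _ hi => (Finset.mem_filter_univ _ |>.1 hi) 0).trans (hT _ (hp 0))
  calc ∑ i, ∑ p ∈ Fintype.piFinset (fun _ : Fin K => τ) with ∀ k, i ∈ T (p k), c p
      = ∑ p ∈ Fintype.piFinset (fun _ : Fin K => τ),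
          (Finset.univ.filter fun i => ∀ k, i ∈ T (p k)).card * c p := by
        simp only [Finset.sum_filter]
        rw [Finset.sum_comm]
        simp only [← Finset.sum_filter, Finset.sum_const, nsmul_eq_mul]
    _ = ∑ p ∈ sharingTuples τ T K 1, (Finset.univ.filter fun i => ∀ k, i ∈ T (p k)).card * c p :=
        (Finset.sum_filter_of_ne fun p _ hne => Nat.one_le_iff_ne_zero.2 fun hcard =>
          hne (by rw [hcard, Nat.cast_zero, zero_mul])).symm
    _ ≤ ∑ p ∈ sharingTuples τ T K 1, m * c p := Finset.sum_le_sum fun p hp => by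
        have := hcommon p (Fintype.mem_piFinset.1 (Finset.mem_filter.1 hp).1)
        have := hc p
        gcongr
    _ = m * ∑ p ∈ sharingTuples τ T K 1, c p := (Finset.mul_sum _ _ _).symm

theorem sum_integral_abs_pow_sum_mainEffect_le {K m : ℕ} [NeZero K] {C : ℝ} (hC0 : 0 ≤ C)
    (hF : ∀ t ∈ τ, DependsOn (F t) (T t : Set ι)) (hT : ∀ t ∈ τ, (T t).card ≤ m)
    (hFK : ∀ t ∈ τ, MemLp (F t) K (Measure.pi P))
    (hC : ∀ i, ∀ t ∈ τ, lpNorm (mainEffect P i (F t)) K (Measure.pi P) ≤ C) :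
    ∑ i, ∫ x, |∑ t ∈ τ, w t * mainEffect P i (F t) x| ^ K ∂Measure.pi P
      ≤ C ^ K * (m * ∑ p ∈ sharingTuples τ T K 1, |∏ k, w (p k)|) := by
  calc ∑ i, ∫ x, |∑ t ∈ τ, w t * mainEffect P i (F t) x| ^ K ∂Measure.pi P
      ≤ ∑ i, C ^ K * ∑ p ∈ Fintype.piFinset (fun _ : Fin K => τ) with ∀ k, i ∈ T (p k),
          |∏ k, w (p k)| :=
        Finset.sum_le_sum fun i _ => integral_abs_pow_sum_mainEffect_le hF hFK (hC i)
    _ ≤ C ^ K * (m * ∑ p ∈ sharingTuples τ T K 1, |∏ k, w (p k)|) := by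
        rw [← Finset.mul_sum]
        gcongr
        exact sum_sum_filter_forall_mem_le hT _ fun p => abs_nonneg _

theorem marginal_weighted_sum_ae_eq (hF : ∀ t ∈ τ, Integrable (F t) (Measure.pi P)) :
    marginal P S (fun x => ∑ t ∈ τ, w t * F t x)
      =ᵐ[Measure.pi P] fun x => ∑ t ∈ τ, w t * marginal P S (F t) x := by
  have hsections : ∀ᵐ x ∂Measure.pi P, ∀ t ∈ τ,
      Integrable (fun y => F t (S.piecewise x y)) (Measure.pi P) :=
    (ae_ball_iff τ.countable_toSet).2 fun t ht =>
      ((measurePreserving_piecewise S).integrable_comp_of_integrable (hF t ht)).prod_right_ae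
  filter_upwards [hsections] with x hx
  simp only [marginal]
  rw [integral_finsetSum _ fun t ht => (hx t ht).const_mul _]
  simp only [integral_const_mul]

theorem mainEffect_weighted_sum_ae_eq (hF : ∀ t ∈ τ, Integrable (F t) (Measure.pi P)) :
    mainEffect P i (fun x => ∑ t ∈ τ, w t * F t x)
      =ᵐ[Measure.pi P] fun x => ∑ t ∈ τ, w t * mainEffect P i (F t) x := by
  filter_upwards [marginal_weighted_sum_ae_eq hF (S := {i}) (w := w)] with x hx
  rw [mainEffect, hx, integral_finsetSum _ fun t ht => (hF t ht).const_mul _]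
  simp only [mainEffect, mul_sub, Finset.sum_sub_distrib, integral_const_mul]

theorem hajekResidual_weighted_sum_ae_eq (hF : ∀ t ∈ τ, Integrable (F t) (Measure.pi P)) :
    hajekResidual P (fun x => ∑ t ∈ τ, w t * F t x)
      =ᵐ[Measure.pi P] fun x => ∑ t ∈ τ, w t * hajekResidual P (F t) x := by
  have heffects := ae_all_iff.2 fun i => mainEffect_weighted_sum_ae_eq hF (i := i) (w := w)
  filter_upwards [heffects] with x hx
  rw [hajekResidual, integral_finsetSum _ fun t ht => (hF t ht).const_mul _,
    Finset.sum_congr rfl fun i _ => hx i, Finset.sum_comm]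
  simp only [hajekResidual, mul_sub, Finset.sum_sub_distrib, integral_const_mul, Finset.mul_sum]

theorem integral_sq_hajekResidual_weighted_sum_le {m : ℕ} {B : ℝ}
    (hF : ∀ t ∈ τ, DependsOn (F t) (T t : Set ι)) (hT : ∀ t ∈ τ, (T t).card ≤ m)
    (hF2 : ∀ t ∈ τ, MemLp (F t) 2 (Measure.pi P))
    (hB : ∀ t ∈ τ, lpNorm (F t) 2 (Measure.pi P) ≤ B) :
    ∫ x, hajekResidual P (fun x => ∑ t ∈ τ, w t * F t x) x ^ 2 ∂Measure.pi P
      ≤ (2 * (1 + m) * B) ^ 2 * ∑ p ∈ sharingTuples τ T 2 2, |∏ k, w (p k)| := by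
  have hcongr := hajekResidual_weighted_sum_ae_eq (w := w)
    fun t ht => (hF2 t ht).integrable one_le_two
  refine (integral_congr_ae (hcongr.fun_comp (· ^ 2))).trans_le <|
    integral_sq_sum_hajekResidual_le hF hF2 fun t ht => ?_
  refine (lpNorm_hajekResidual_le one_le_two (by simp) (hF t ht) (hF2 t ht)).trans ?_
  have hcard : ((T t).card : ℝ) ≤ m := mod_cast hT t ht
  exact mul_le_mul (by gcongr) (hB t ht) lpNorm_nonneg (by positivity)

theorem sum_integral_abs_pow_mainEffect_weighted_sum_le {K m : ℕ} [NeZero K] {B : ℝ}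
    (hB0 : 0 ≤ B) (hF : ∀ t ∈ τ, DependsOn (F t) (T t : Set ι)) (hT : ∀ t ∈ τ, (T t).card ≤ m)
    (hFK : ∀ t ∈ τ, MemLp (F t) K (Measure.pi P))
    (hB : ∀ t ∈ τ, lpNorm (F t) K (Measure.pi P) ≤ B) :
    ∑ i, ∫ x, |mainEffect P i (fun x => ∑ t ∈ τ, w t * F t x) x| ^ K ∂Measure.pi P
      ≤ (2 * B) ^ K * (m * ∑ p ∈ sharingTuples τ T K 1, |∏ k, w (p k)|) := by
  have hK : (1 : ENNReal) ≤ K := by exact_mod_cast NeZero.one_le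
  have hcongr (i : ι) := mainEffect_weighted_sum_ae_eq (P := P) (i := i) (w := w)
    fun t ht => (hFK t ht).integrable hK
  refine (Finset.sum_congr rfl fun i _ =>
    integral_congr_ae ((hcongr i).fun_comp (|·| ^ K))).trans_le ?_
  exact sum_integral_abs_pow_sum_mainEffect_le (by positivity) hF hT hFK fun i t ht =>
    (lpNorm_mainEffect_le hK (by simp) (hFK t ht)).trans
      (mul_le_mul_of_nonneg_left (hB t ht) zero_le_two)

theorem variance_sum_mainEffect_weighted_sum
    (hF : ∀ t ∈ τ, Integrable (F t) (Measure.pi P)) :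
    Var[fun x => ∑ i, mainEffect P i (fun x => ∑ t ∈ τ, w t * F t x) x; Measure.pi P]
      = Var[fun x => ∑ i, ∑ t ∈ τ, w t * mainEffect P i (F t) x; Measure.pi P] := by
  have hcongr := ae_all_iff.2 fun i => mainEffect_weighted_sum_ae_eq hF (i := i) (w := w)
  exact variance_congr (hcongr.mono fun x hx => Finset.sum_congr rfl fun i _ => hx i)

end ProductSpace

section HajekProjection

variable {ι : ℕ → Type*} [∀ n, Fintype (ι n)] [∀ n, DecidableEq (ι n)] {𝓧 : ∀ n, ι n → Type*}
  [∀ n i, MeasurableSpace (𝓧 n i)] {P : ∀ n i, Measure (𝓧 n i)}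
  [∀ n i, IsProbabilityMeasure (P n i)] {F : ∀ n, (∀ i, 𝓧 n i) → ℝ} {V : ℕ → ℝ}

theorem tendsto_variance_div_variance_sum_mainEffect
    (hF : ∀ n, MemLp (F n) 2 (Measure.pi (P n)))
    (hV : ∀ n, V n = Var[fun x => ∑ i, mainEffect (P n) i (F n) x; Measure.pi (P n)])
    (hpos : ∀ᶠ n in atTop, 0 < V n)
    (hsmall : Tendsto (fun n => (∫ x, hajekResidual (P n) (F n) x ^ 2 ∂Measure.pi (P n)) / V n)
      atTop (𝓝 0)) :
    Tendsto (fun n => Var[F n; Measure.pi (P n)] / V n) atTop (𝓝 1) := by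
  refine (show Tendsto _ atTop (𝓝 (1 : ℝ)) by simpa using hsmall.const_add 1).congr' ?_
  filter_upwards [hpos] with n hn
  rw [variance_eq_variance_sum_mainEffect_add (hF n), ← hV n, add_div, div_self hn.ne']

theorem tendstoInDistribution_standardized_of_hajekResidual
    (hmeas : ∀ n, Measurable (F n)) (hF : ∀ n, MemLp (F n) 3 (Measure.pi (P n)))
    (hV : ∀ n, V n = Var[fun x => ∑ i, mainEffect (P n) i (F n) x; Measure.pi (P n)])
    (hpos : ∀ᶠ n in atTop, 0 < V n)
    (hsmall : Tendsto (fun n => (∫ x, hajekResidual (P n) (F n) x ^ 2 ∂Measure.pi (P n)) / V n)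
      atTop (𝓝 0))
    (hlyapunov : Tendsto (fun n => V n ^ (-(3 / 2) : ℝ) *
      ∑ i, ∫ x, |mainEffect (P n) i (F n) x| ^ 3 ∂Measure.pi (P n)) atTop (𝓝 0)) :
    TendstoInDistribution
      (fun n x => Var[F n; Measure.pi (P n)] ^ (-(1 / 2) : ℝ)
        * (F n x - ∫ y, F n y ∂Measure.pi (P n)))
      atTop (id : ℝ → ℝ) (fun n => Measure.pi (P n)) (gaussianReal 0 1) := by
  have hF2 (n : ℕ) : MemLp (F n) 2 (Measure.pi (P n)) := (hF n).mono_exponent (by norm_num)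
  simp only [sub_integral_eq_sum_mainEffect_add]
  refine tendstoInDistribution_standardized_sum_add
    (fun n i => memLp_mainEffect (by norm_num) (by simp) (hF n))
    (fun n => iIndepFun_of_dependsOn_singleton (fun i => measurable_mainEffect (hmeas n))
      fun i => dependsOn_mainEffect)
    (fun n i => integral_mainEffect ((hF2 n).integrable one_le_two))
    (fun n => memLp_hajekResidual one_le_two (by simp) (hF2 n)) hV hpos (fun n => ?_)
    (tendsto_variance_div_variance_sum_mainEffect hF2 hV hpos hsmall) hsmall hlyapunov
  rw [variance_eq_variance_sum_mainEffect_add (hF2 n), ← hV n]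
  exact le_add_of_nonneg_right (integral_nonneg fun x => sq_nonneg _)

theorem tendsto_variance_div_and_standardized_of_sharingTuples {β : ℕ → Type*}
    {τ : ∀ n, Finset (β n)} {T : ∀ n, β n → Finset (ι n)} {w : ∀ n, β n → ℝ}
    {F : ∀ n, β n → (∀ i, 𝓧 n i) → ℝ} {m : ℕ} {B : ℕ → ℝ} (hB0 : ∀ n, 0 ≤ B n)
    (hmeas : ∀ n, ∀ t ∈ τ n, Measurable (F n t))
    (hdep : ∀ n, ∀ t ∈ τ n, DependsOn (F n t) (T n t : Set (ι n)))
    (hT : ∀ n, ∀ t ∈ τ n, (T n t).card ≤ m)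
    (hF : ∀ n, ∀ t ∈ τ n, MemLp (F n t) 3 (Measure.pi (P n)))
    (hB : ∀ n, ∀ t ∈ τ n, lpNorm (F n t) 3 (Measure.pi (P n)) ≤ B n)
    {S : ∀ n, (∀ i, 𝓧 n i) → ℝ} (hS : ∀ n x, S n x = ∑ t ∈ τ n, w n t * F n t x)
    (hV : ∀ n, V n = Var[fun x => ∑ i, mainEffect (P n) i (S n) x; Measure.pi (P n)])
    (hpos : ∀ᶠ n in atTop, 0 < V n)
    (hpairs : Tendsto (fun n => B n ^ 2 * (∑ p ∈ sharingTuples (τ n) (T n) 2 2,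
      |∏ k, w n (p k)|) / V n) atTop (𝓝 0))
    (htriples : Tendsto (fun n => V n ^ (-(3 / 2) : ℝ) * (B n ^ 3 *
      ∑ p ∈ sharingTuples (τ n) (T n) 3 1, |∏ k, w n (p k)|)) atTop (𝓝 0)) :
    Tendsto (fun n => Var[S n; Measure.pi (P n)] / V n) atTop (𝓝 1) ∧
      TendstoInDistribution
        (fun n x => Var[S n; Measure.pi (P n)] ^ (-(1 / 2) : ℝ)
          * (S n x - ∫ y, S n y ∂Measure.pi (P n)))
        atTop (id : ℝ → ℝ) (fun n => Measure.pi (P n)) (gaussianReal 0 1) := by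
  obtain rfl : S = fun n x => ∑ t ∈ τ n, w n t * F n t x := funext₂ hS
  have hF2 (n : ℕ) (t : β n) (ht : t ∈ τ n) : MemLp (F n t) 2 (Measure.pi (P n)) :=
    (hF n t ht).mono_exponent (by norm_num)
  have hB2 (n : ℕ) (t : β n) (ht : t ∈ τ n) : lpNorm (F n t) 2 (Measure.pi (P n)) ≤ B n :=
    (lpNorm_le_lpNorm_of_exponent_le (by norm_num) (hF n t ht)).trans (hB n t ht)
  have hS3 (n : ℕ) : MemLp (fun x => ∑ t ∈ τ n, w n t * F n t x) 3 (Measure.pi (P n)) :=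
    memLp_finsetSum _ fun t ht => (hF n t ht).const_mul _
  have hsmall : Tendsto (fun n => (∫ x, hajekResidual (P n)
      (fun x => ∑ t ∈ τ n, w n t * F n t x) x ^ 2 ∂Measure.pi (P n)) / V n) atTop (𝓝 0) := by
    have hlimit := hpairs.const_mul ((2 * (1 + m)) ^ 2 : ℝ)
    rw [mul_zero] at hlimit
    refine squeeze_zero' (hpos.mono fun n hn => by positivity) (hpos.mono fun n hn => ?_) hlimit
    rw [← mul_div_assoc, ← mul_assoc, ← mul_pow]
    gcongr
    exact integral_sq_hajekResidual_weighted_sum_le (hdep n) (hT n) (hF2 n) (hB2 n)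
  have hlyapunov : Tendsto (fun n => V n ^ (-(3 / 2) : ℝ) * ∑ i, ∫ x, |mainEffect (P n) i
      (fun x => ∑ t ∈ τ n, w n t * F n t x) x| ^ 3 ∂Measure.pi (P n)) atTop (𝓝 0) := by
    have hlimit := htriples.const_mul (2 ^ 3 * m : ℝ)
    rw [mul_zero] at hlimit
    refine squeeze_zero' (hpos.mono fun n hn => by positivity) (hpos.mono fun n hn => ?_) hlimit
    rw [mul_left_comm]
    gcongr
    refine (sum_integral_abs_pow_mainEffect_weighted_sum_le (hB0 n) (hdep n) (hT n) (hF n)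
      (hB n)).trans_eq ?_
    ring
  exact ⟨tendsto_variance_div_variance_sum_mainEffect
      (fun n => (hS3 n).mono_exponent (by norm_num)) hV hpos hsmall,
    tendstoInDistribution_standardized_of_hajekResidual
      (fun n => Finset.measurable_sum _ fun t ht => (hmeas n t ht).const_mul _) hS3 hV hpos hsmall
      hlyapunov⟩

end HajekProjection

section Counting

variable {n m K q : ℕ}

theorem pow_mul_card_matching_le (e : Fin (K + 1) → Fin q → Fin m)
    (he : ∀ k, Function.Injective (e k)) :
    n ^ (q * K) * (Finset.univ.filter fun t : Fin (K + 1) → Fin m → Fin n =>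
      ∀ k r, t k (e k r) = t 0 (e 0 r)).card ≤ n ^ ((K + 1) * m) := by
  -- overwrite the matched entries of all tuples but the first with the free values `p.1`
  let overwrite (p : (Fin K → Fin q → Fin n) × (Fin (K + 1) → Fin m → Fin n)) :
      Fin (K + 1) → Fin m → Fin n :=
    Fin.cons (p.2 0) fun k => Function.extend (e k.succ) (p.1 k) (p.2 k.succ)
  have hinj : Set.InjOn overwrite ↑((Finset.univ : Finset (Fin K → Fin q → Fin n)) ×ˢ
      Finset.univ.filter fun t : Fin (K + 1) → Fin m → Fin n =>
        ∀ k r, t k (e k r) = t 0 (e 0 r)) := by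
    rintro ⟨u, t⟩ ht ⟨u', t'⟩ ht' heq
    replace ht := (Finset.mem_filter.1 (Finset.mem_product.1 ht).2).2
    replace ht' := (Finset.mem_filter.1 (Finset.mem_product.1 ht').2).2
    obtain ⟨hhead, htail⟩ := Fin.cons_inj.1 heq
    have hextend (k : Fin K) (j : Fin m) : Function.extend (e k.succ) (u k) (t k.succ) j
        = Function.extend (e k.succ) (u' k) (t' k.succ) j := congrFun (congrFun htail k) j
    refine Prod.ext (funext₂ fun k r => ?_) (funext fun k => Fin.cases hhead (fun k => ?_) k)
    · simpa only [(he k.succ).extend_apply] using hextend k (e k.succ r)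
    · funext j
      by_cases hj : ∃ r, e k.succ r = j
      · obtain ⟨r, rfl⟩ := hj
        exact (ht k.succ r).trans ((congrFun hhead _).trans (ht' k.succ r).symm)
      · simpa only [Function.extend_apply' _ _ _ hj] using hextend k j
  have hcard := Finset.card_le_card_of_injOn overwrite (fun _ _ => Finset.mem_univ _) hinj
  simpa [Finset.card_product, ← pow_mul, mul_comm] using hcard

theorem exists_matching_of_mem_sharingSet {t : Fin (K + 1) → Fin m → Fin n}
    (ht : t ∈ sharingSet n m (K + 1) q) :
    ∃ e : Fin (K + 1) → Fin q → Fin m, (∀ k, Function.Injective (e k)) ∧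
      ∀ k r, t k (e k r) = t 0 (e 0 r) := by
  obtain ⟨-, -, hcard⟩ := Finset.mem_filter.1 ht
  obtain ⟨s, hs, hsq⟩ := Finset.exists_subset_card_eq hcard
  let f : Fin q ↪o Fin n := s.orderEmbOfFin hsq
  have hcommon (k : Fin (K + 1)) (r : Fin q) : ∃ j, t k j = f r :=
    (Finset.mem_filter.1 (hs (s.orderEmbOfFin_mem hsq r))).2 k
  choose e he using hcommon
  exact ⟨e, fun k => .of_comp (f := t k) (by simpa only [Function.comp_def, he] using f.injective),
    fun k r => by rw [he, he]⟩

theorem pow_mul_card_sharingSet_le :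
    n ^ (q * K) * (sharingSet n m (K + 1) q).card ≤ m ^ (q * (K + 1)) * n ^ ((K + 1) * m) := by
  have hcover : sharingSet n m (K + 1) q ⊆
      (Finset.univ.filter fun e : Fin (K + 1) → Fin q → Fin m =>
        ∀ k, Function.Injective (e k)).biUnion fun e =>
        Finset.univ.filter fun t => ∀ k r, t k (e k r) = t 0 (e 0 r) := fun t ht => by
    simpa using exists_matching_of_mem_sharingSet ht
  calc n ^ (q * K) * (sharingSet n m (K + 1) q).card
      ≤ ∑ e : Fin (K + 1) → Fin q → Fin m with ∀ k, Function.Injective (e k), n ^ (q * K) *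
          (Finset.univ.filter fun t : Fin (K + 1) → Fin m → Fin n =>
            ∀ k r, t k (e k r) = t 0 (e 0 r)).card := by
        rw [← Finset.mul_sum]
        exact Nat.mul_le_mul_left _ ((Finset.card_le_card hcover).trans Finset.card_biUnion_le)
    _ ≤ ∑ e : Fin (K + 1) → Fin q → Fin m with ∀ k, Function.Injective (e k), n ^ ((K + 1) * m) :=
        Finset.sum_le_sum fun e he => pow_mul_card_matching_le e (Finset.mem_filter.1 he).2
    _ ≤ m ^ (q * (K + 1)) * n ^ ((K + 1) * m) := by
        rw [Finset.sum_const, smul_eq_mul]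
        gcongr
        simpa [pow_mul] using
          Finset.card_filter_le (Finset.univ : Finset (Fin (K + 1) → Fin q → Fin m)) fun e =>
            ∀ k, Function.Injective (e k)

/-- The normalising factor of a U-statistic of degree `m` on a sample of size `n`; the truncated
subtraction makes it a junk value for `n < m`. -/
noncomputable def normalizer (n m : ℕ) : ℝ := ((n - m).factorial : ℝ) / (n.factorial : ℝ)

theorem normalizer_nonneg : 0 ≤ normalizer n m := by
  unfold normalizer
  positivity

theorem normalizer_mul_pow_le (hn : 2 * m ≤ n) : normalizer n m * (n : ℝ) ^ m ≤ 2 ^ m := by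
  have hpow : n ^ m ≤ 2 ^ m * n.descFactorial m :=
    calc n ^ m ≤ (2 * (n + 1 - m)) ^ m := Nat.pow_le_pow_left (by omega) _
      _ = 2 ^ m * (n + 1 - m) ^ m := mul_pow _ _ _
      _ ≤ 2 ^ m * n.descFactorial m := Nat.mul_le_mul_left _ (Nat.pow_sub_le_descFactorial n m)
  rw [normalizer, div_mul_eq_mul_div, div_le_iff₀ (by positivity),
    ← Nat.factorial_mul_descFactorial (by omega : m ≤ n), Nat.cast_mul, mul_left_comm]
  exact mul_le_mul_of_nonneg_left (mod_cast hpow) (by positivity)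

theorem sum_sharingSet_eq_card_mul_avgWeight (a : (Fin m → Fin n) → ℝ) :
    ∑ t ∈ sharingSet n m K q, |∏ k, a (t k)| = (sharingSet n m K q).card * avgWeight a K q := by
  rcases (sharingSet n m K q).eq_empty_or_nonempty with hempty | hne
  · simp [hempty]
  · rw [avgWeight, mul_inv_cancel_left₀ (by exact_mod_cast hne.card_pos.ne')]

theorem normalizer_pow_mul_sum_sharingSet_le (hn : 2 * m ≤ n) (a : (Fin m → Fin n) → ℝ) :
    (n : ℝ) ^ (q * K) * (normalizer n m ^ (K + 1) * ∑ t ∈ sharingSet n m (K + 1) q, |∏ k, a (t k)|)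
      ≤ 2 ^ (m * (K + 1)) * m ^ (q * (K + 1)) * avgWeight a (K + 1) q := by
  have havg : 0 ≤ avgWeight a (K + 1) q :=
    mul_nonneg (by positivity) (Finset.sum_nonneg fun _ _ => abs_nonneg _)
  have hcard : (n : ℝ) ^ (q * K) * (sharingSet n m (K + 1) q).card
      ≤ m ^ (q * (K + 1)) * n ^ ((K + 1) * m) := mod_cast pow_mul_card_sharingSet_le
  have hc := normalizer_nonneg (n := n) (m := m)
  calc (n : ℝ) ^ (q * K) * (normalizer n m ^ (K + 1) *
        ∑ t ∈ sharingSet n m (K + 1) q, |∏ k, a (t k)|)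
      = normalizer n m ^ (K + 1) * ((n : ℝ) ^ (q * K) * (sharingSet n m (K + 1) q).card)
        * avgWeight a (K + 1) q := by
        rw [sum_sharingSet_eq_card_mul_avgWeight]
        ring
    _ ≤ normalizer n m ^ (K + 1) * (m ^ (q * (K + 1)) * n ^ ((K + 1) * m))
        * avgWeight a (K + 1) q := by gcongr
    _ = (normalizer n m * n ^ m) ^ (K + 1) * m ^ (q * (K + 1)) * avgWeight a (K + 1) q := by ring
    _ ≤ (2 ^ m) ^ (K + 1) * m ^ (q * (K + 1)) * avgWeight a (K + 1) q := by
        gcongr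
        exact normalizer_mul_pow_le hn
    _ = 2 ^ (m * (K + 1)) * m ^ (q * (K + 1)) * avgWeight a (K + 1) q := by rw [← pow_mul]

end Counting

section FirstOrder

theorem measurePreserving_comp_of_injective {ι κ : Type*} [Fintype ι] [Fintype κ] {𝓧 : ι → Type*}
    [∀ i, MeasurableSpace (𝓧 i)] (P : ∀ i, Measure (𝓧 i)) [∀ i, IsProbabilityMeasure (P i)]
    {t : κ → ι} (ht : Function.Injective t) :
    MeasurePreserving (fun x : ∀ i, 𝓧 i => fun j => x (t j)) (Measure.pi P)
      (Measure.pi fun j => P (t j)) := by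
  refine ⟨by fun_prop, ?_⟩
  have hindep : iIndepFun (fun i (x : ∀ i, 𝓧 i) => x i) (Measure.pi P) :=
    iIndepFun_pi (X := fun _ => id) fun _ => aemeasurable_id
  rw [(hindep.precomp ht).map_fun_eq_pi_map fun j => (measurable_pi_apply _).aemeasurable]
  exact congrArg Measure.pi (funext fun j => (measurePreserving_eval P (t j)).map_eq)

variable {𝓧 : Type*} {n k : ℕ}

theorem dependsOn_comp_tuple {m : ℕ} (h : (Fin m → 𝓧) → ℝ) (t : Fin m → Fin n) :
    DependsOn (fun x : Fin n → 𝓧 => h fun j => x (t j)) (Finset.univ.image t : Set (Fin n)) :=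
  fun _ _ hx => congrArg h (funext fun j => hx _ (by simp))

theorem piecewise_singleton_comp_tuple {t : Fin (k + 1) → Fin n} (ht : Function.Injective t)
    (l : Fin (k + 1)) (x y : Fin n → 𝓧) :
    (fun j => ({t l} : Finset (Fin n)).piecewise x y (t j))
      = l.insertNth (x (t l)) fun j => y (l.removeNth t j) := by
  refine Fin.eq_insertNth_iff.2 ⟨by simp, funext fun j => ?_⟩
  exact Finset.piecewise_eq_of_notMem _ _ _ (by simp [ht.eq_iff, Fin.succAbove_ne])

theorem injective_insertNth_iff {l : Fin (k + 1)} {i : Fin n} {s : Fin k → Fin n} :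
    Function.Injective (l.insertNth (α := fun _ => Fin n) i s) ↔
      Function.Injective s ∧ ∀ j, s j ≠ i := by
  simp only [Function.Injective, l.forall_iff_succAbove, Fin.insertNth_apply_same,
    Fin.insertNth_apply_succAbove, Fin.succAbove_right_inj]
  grind [Fin.succAbove_ne]

theorem sum_indexSetExcept_insertNth (i : Fin n) (l : Fin (k + 1))
    (G : (Fin (k + 1) → Fin n) → ℝ) :
    ∑ s ∈ indexSetExcept n k i, G (l.insertNth i s)
      = ∑ t ∈ indexSet n (k + 1) with t l = i, G t := by
  refine Finset.sum_nbij (fun s => l.insertNth (α := fun _ => Fin n) i s) (fun s hs => ?_)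
    (Fin.insertNth_right_injective (α := fun _ => Fin n) (p := l) i).injOn (fun t ht => ?_)
    fun _ _ => rfl
  · simpa [indexSet, indexSetExcept, injective_insertNth_iff] using hs
  · obtain ⟨hinj, rfl⟩ := Finset.mem_filter.1 ht
    refine ⟨l.removeNth t, ?_, Fin.insertNth_self_removeNth l t⟩
    simpa [indexSet, indexSetExcept, ← injective_insertNth_iff (l := l)] using hinj

variable [MeasurableSpace 𝓧] {P : Fin n → Measure 𝓧} [∀ i, IsProbabilityMeasure (P i)]

theorem integral_comp_tuple {m : ℕ} {h : (Fin m → 𝓧) → ℝ} (hh : Measurable h)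
    {t : Fin m → Fin n} (ht : Function.Injective t) :
    ∫ x, h (fun j => x (t j)) ∂Measure.pi P = theta h P t := by
  rw [theta, ← (measurePreserving_comp_of_injective P ht).map_eq,
    integral_map (measurePreserving_comp_of_injective P ht).aemeasurable hh.aestronglyMeasurable]

theorem marginal_singleton_comp_tuple {h : (Fin (k + 1) → 𝓧) → ℝ} (hh : Measurable h)
    {t : Fin (k + 1) → Fin n} (ht : Function.Injective t) (l : Fin (k + 1)) (x : Fin n → 𝓧) :
    marginal P {t l} (fun x => h fun j => x (t j)) x = proj h P l (l.removeNth t) (x (t l)) := by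
  have hremove : Function.Injective (l.removeNth t) := ht.comp Fin.succAbove_right_injective
  have hsection : Measurable fun y : Fin k → 𝓧 =>
      h (l.insertNth (α := fun _ => 𝓧) (x (t l)) y) :=
    hh.comp ((MeasurableEquiv.piFinSuccAbove (fun _ => 𝓧) l).symm.measurable.comp
      measurable_prodMk_left)
  simp only [marginal, piecewise_singleton_comp_tuple ht]
  exact integral_comp_tuple hsection hremove

theorem mainEffect_comp_tuple {h : (Fin (k + 1) → 𝓧) → ℝ} (hh : Measurable h)
    {t : Fin (k + 1) → Fin n} (ht : Function.Injective t) (i : Fin n) (x : Fin n → 𝓧) :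
    mainEffect P i (fun x => h fun j => x (t j)) x
      = ∑ l with t l = i, (proj h P l (l.removeNth t) (x i) - theta h P t) := by
  by_cases hi : ∃ l, t l = i
  · obtain ⟨l, rfl⟩ := hi
    have hfiber : (Finset.univ.filter fun l' => t l' = t l) = {l} := by
      ext l'
      simp [ht.eq_iff]
    rw [hfiber, Finset.sum_singleton, mainEffect, marginal_singleton_comp_tuple hh ht,
      integral_comp_tuple hh ht]
  · rw [mainEffect_eq_zero_of_notMem (dependsOn_comp_tuple h t) (by simpa using hi),
      Finset.filter_false_of_mem fun l _ hl => hi ⟨l, hl⟩, Finset.sum_empty, Pi.zero_apply]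

theorem inv_mul_firstOrder_eq {h : (Fin (k + 1) → 𝓧) → ℝ} (hh : Measurable h)
    (a : (Fin (k + 1) → Fin n) → ℝ) (i : Fin n) (x : Fin n → 𝓧) :
    (n : ℝ)⁻¹ * firstOrder a h P i (x i)
      = ∑ t ∈ indexSet n (k + 1), normalizer n (k + 1) * a t
          * mainEffect P i (fun x => h fun j => x (t j)) x := by
  have hconstant : (n : ℝ)⁻¹ * (((n - (k + 1)).factorial : ℝ) / ((n - 1).factorial : ℝ))
      = normalizer n (k + 1) := by
    rw [normalizer, ← Nat.mul_factorial_pred i.pos.ne', Nat.cast_mul]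
    field_simp
  have hposition (l : Fin (k + 1)) : ∑ s ∈ indexSetExcept n k i,
        a (l.insertNth i s) * (proj h P l s (x i) - theta h P (l.insertNth i s))
      = ∑ t ∈ indexSet n (k + 1) with t l = i,
          a t * (proj h P l (l.removeNth t) (x i) - theta h P t) := by
    simp only [← sum_indexSetExcept_insertNth, Fin.removeNth_insertNth]
  simp only [firstOrder, firstOrderAt]
  rw [← mul_assoc, hconstant, Finset.sum_comm, Finset.sum_congr rfl fun l _ => hposition l]
  simp only [Finset.sum_filter]
  rw [Finset.sum_comm, Finset.mul_sum]
  refine Finset.sum_congr rfl fun t ht => ?_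
  rw [mainEffect_comp_tuple hh (Finset.mem_filter.1 ht).2, Finset.sum_filter]
  simp only [mul_assoc, Finset.mul_sum, mul_ite, mul_zero]

end FirstOrder

section UStatistic

theorem tendstoInDistribution_comp_measurePreserving {ι E Ω₀ : Type*} {Ω Ω' : ι → Type*}
    [∀ i, MeasurableSpace (Ω i)] [∀ i, MeasurableSpace (Ω' i)] [MeasurableSpace Ω₀]
    [TopologicalSpace E] [MeasurableSpace E] [OpensMeasurableSpace E]
    {μ : ∀ i, Measure (Ω i)} [∀ i, IsProbabilityMeasure (μ i)]
    {ν : ∀ i, Measure (Ω' i)} [∀ i, IsProbabilityMeasure (ν i)]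
    {μ₀ : Measure Ω₀} [IsProbabilityMeasure μ₀] {g : ∀ i, Ω i → Ω' i} {Y : ∀ i, Ω' i → E}
    {Z : Ω₀ → E} {l : Filter ι} (hg : ∀ i, MeasurePreserving (g i) (μ i) (ν i))
    (hY : TendstoInDistribution Y l Z ν μ₀) :
    TendstoInDistribution (fun i ω => Y i (g i ω)) l Z μ μ₀ where
  forall_aemeasurable i := (hY.forall_aemeasurable i).comp_quasiMeasurePreserving
    (hg i).quasiMeasurePreserving
  aemeasurable_limit := hY.aemeasurable_limit
  tendsto := by
    refine hY.tendsto.congr fun i => Subtype.ext ?_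
    have hYi : AEMeasurable (Y i) ((μ i).map (g i)) := (hg i).map_eq ▸ hY.forall_aemeasurable i
    change (ν i).map (Y i) = (μ i).map (Y i ∘ g i)
    rw [← AEMeasurable.map_map_of_aemeasurable hYi (hg i).aemeasurable, (hg i).map_eq]

theorem sharingSet_eq_sharingTuples (n m K q : ℕ) :
    sharingSet n m K q = sharingTuples (indexSet n m) (fun t => Finset.univ.image t) K q := by
  ext p
  rw [sharingSet, sharingTuples, Finset.mem_filter_univ, Finset.mem_filter, Fintype.mem_piFinset]
  simp only [commonIndices, Finset.mem_image, Finset.mem_univ, true_and]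

theorem uStat_eq_sum {𝓧 : Type*} {n m : ℕ} (a : (Fin m → Fin n) → ℝ) (h : (Fin m → 𝓧) → ℝ)
    (x : Fin n → 𝓧) :
    uStat a h x = ∑ t ∈ indexSet n m, normalizer n m * a t * h fun j => x (t j) := by
  simp only [uStat, normalizer, Finset.mul_sum, mul_assoc]

theorem measurable_comp_tuple {ι 𝓧 : Type*} [MeasurableSpace 𝓧] {m : ℕ} {h : (Fin m → 𝓧) → ℝ}
    (hh : Measurable h) (t : Fin m → ι) : Measurable fun x : ι → 𝓧 => h fun j => x (t j) :=
  hh.comp (measurable_pi_lambda _ fun j => measurable_pi_apply (t j))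

theorem measurable_uStat {𝓧 : Type*} [MeasurableSpace 𝓧] {n m : ℕ} (a : (Fin m → Fin n) → ℝ)
    {h : (Fin m → 𝓧) → ℝ} (hh : Measurable h) : Measurable (uStat a h) :=
  (Finset.measurable_sum _ fun t _ => (measurable_comp_tuple hh t).const_mul (a t)).const_mul _

theorem measurePreserving_of_iIndepFun {Ω ι : Type*} [MeasurableSpace Ω] [Fintype ι]
    {𝓧 : ι → Type*} [∀ i, MeasurableSpace (𝓧 i)] {μ : Measure Ω} {X : ∀ i, Ω → 𝓧 i}
    (hX : ∀ i, Measurable (X i)) (hindep : iIndepFun X μ) :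
    MeasurePreserving (fun ω i => X i ω) μ (Measure.pi fun i => μ.map (X i)) :=
  ⟨measurable_pi_lambda _ hX, hindep.map_fun_eq_pi_map fun i => (hX i).aemeasurable⟩

theorem mainVar_eq_variance_sum_mainEffect {Ω 𝓧 : Type*} [MeasurableSpace Ω] [MeasurableSpace 𝓧]
    {n k : ℕ} {μ : Measure Ω} [IsProbabilityMeasure μ] {h : (Fin (k + 1) → 𝓧) → ℝ}
    (hh : Measurable h) {X : Fin n → Ω → 𝓧} (hX : ∀ i, Measurable (X i)) (hindep : iIndepFun X μ)
    (hint : ∀ t ∈ indexSet n (k + 1), Integrable (fun x => h fun j => x (t j))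
      (Measure.pi fun i => μ.map (X i))) (a : (Fin (k + 1) → Fin n) → ℝ) :
    mainVar a h μ X = Var[fun x => ∑ i, mainEffect (fun i => μ.map (X i)) i (uStat a h) x;
      Measure.pi fun i => μ.map (X i)] := by
  have (i : Fin n) : IsProbabilityMeasure (μ.map (X i)) :=
    Measure.isProbabilityMeasure_map (hX i).aemeasurable
  rw [funext (uStat_eq_sum a h), variance_sum_mainEffect_weighted_sum hint,
    ← (measurePreserving_of_iIndepFun hX hindep).variance_fun_comp, mainVar]
  · congr 1 with ω
    rw [Finset.mul_sum]
    exact Finset.sum_congr rfl fun i _ => inv_mul_firstOrder_eq hh a i fun i => X i ω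
  · refine Measurable.aemeasurable <| Finset.measurable_sum _ fun i _ =>
      Finset.measurable_sum _ fun t _ =>
        (measurable_mainEffect (measurable_comp_tuple hh t)).const_mul _

theorem tendsto_mul_sum_sharingTuples {m K q : ℕ} {a : ∀ n, (Fin m → Fin n) → ℝ} {c : ℕ → ℝ}
    (hc : ∀ᶠ n in atTop, 0 ≤ c n)
    (hlim : Tendsto (fun n : ℕ => ((n : ℝ) ^ (q * K))⁻¹ * c n * avgWeight (a n) (K + 1) q)
      atTop (𝓝 0)) :
    Tendsto (fun n => c n * ∑ p ∈ sharingTuples (indexSet n m) (fun t => Finset.univ.image t)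
      (K + 1) q, |∏ k, normalizer n m * a n (p k)|) atTop (𝓝 0) := by
  have hbound := hlim.const_mul (2 ^ (m * (K + 1)) * m ^ (q * (K + 1)) : ℝ)
  rw [mul_zero] at hbound
  refine squeeze_zero' (hc.mono fun n hn => by positivity) ?_ hbound
  filter_upwards [hc, eventually_ge_atTop (2 * m), eventually_gt_atTop 0] with n hn hmn hn0
  have hfactor : ∑ p ∈ sharingTuples (indexSet n m) (fun t => Finset.univ.image t) (K + 1) q,
        |∏ k, normalizer n m * a n (p k)|
      = normalizer n m ^ (K + 1) * ∑ p ∈ sharingSet n m (K + 1) q, |∏ k, a n (p k)| := by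
    simp only [sharingSet_eq_sharingTuples, Finset.prod_mul_distrib, Finset.prod_const,
      Finset.card_univ, Fintype.card_fin, abs_mul, abs_pow, abs_of_nonneg normalizer_nonneg,
      Finset.mul_sum]
  rw [hfactor]
  have hrate := normalizer_pow_mul_sum_sharingSet_le (q := q) (K := K) hmn (a n)
  rw [← le_div_iff₀' (by positivity)] at hrate
  refine (mul_le_mul_of_nonneg_left hrate hn).trans_eq ?_
  ring

theorem tendsto_variance_div_and_standardized_comp {Ω Ω' : ℕ → Type*}
    [∀ n, MeasurableSpace (Ω n)] [∀ n, MeasurableSpace (Ω' n)]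
    {μ : ∀ n, Measure (Ω n)} [∀ n, IsProbabilityMeasure (μ n)]
    {ν : ∀ n, Measure (Ω' n)} [∀ n, IsProbabilityMeasure (ν n)]
    {g : ∀ n, Ω n → Ω' n} (hg : ∀ n, MeasurePreserving (g n) (μ n) (ν n))
    {F : ∀ n, Ω' n → ℝ} (hF : ∀ n, Measurable (F n)) {V : ℕ → ℝ}
    (hlim : Tendsto (fun n => Var[F n; ν n] / V n) atTop (𝓝 1) ∧
      TendstoInDistribution (fun n x => Var[F n; ν n] ^ (-(1 / 2) : ℝ) * (F n x - ∫ y, F n y ∂ν n))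
        atTop (id : ℝ → ℝ) ν (gaussianReal 0 1)) :
    Tendsto (fun n => Var[fun ω => F n (g n ω); μ n] / V n) atTop (𝓝 1) ∧
      TendstoInDistribution
        (fun n ω => Var[fun ω => F n (g n ω); μ n] ^ (-(1 / 2) : ℝ)
          * (F n (g n ω) - ∫ ω', F n (g n ω') ∂μ n))
        atTop (id : ℝ → ℝ) μ (gaussianReal 0 1) := by
  have hvar (n : ℕ) : Var[fun ω => F n (g n ω); μ n] = Var[F n; ν n] :=
    (hg n).variance_fun_comp (hF n).aemeasurable
  have hmean (n : ℕ) : ∫ ω, F n (g n ω) ∂μ n = ∫ x, F n x ∂ν n := by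
    rw [← (hg n).map_eq, integral_map (hg n).aemeasurable (hF n).aestronglyMeasurable]
  simp only [hvar, hmean]
  obtain ⟨hratio, hnormal⟩ := hlim
  have htransport := tendstoInDistribution_comp_measurePreserving hg hnormal
  exact ⟨hratio, htransport⟩

theorem tendsto_variance_div_and_standardized_uStat {𝓧 : ℕ → Type*}
    [∀ n, MeasurableSpace (𝓧 n)] {P : ∀ n, Fin n → Measure (𝓧 n)}
    [∀ n i, IsProbabilityMeasure (P n i)] {m : ℕ} {a : ∀ n, (Fin m → Fin n) → ℝ}
    {h : ∀ n, (Fin m → 𝓧 n) → ℝ} (hh : ∀ n, Measurable (h n)) {M : ℕ → ℝ} (hM : ∀ n, 0 ≤ M n)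
    (hmoment : ∀ n, ∀ t ∈ indexSet n m,
      MemLp (fun x => h n fun j => x (t j)) 3 (Measure.pi (P n)) ∧
        lpNorm (fun x => h n fun j => x (t j)) 3 (Measure.pi (P n)) ≤ M n ^ (1 / 3 : ℝ))
    {V : ℕ → ℝ} (hV : ∀ n, V n = Var[fun x => ∑ i, mainEffect (P n) i (uStat (a n) (h n)) x;
      Measure.pi (P n)])
    (hVpos : ∀ᶠ n in atTop, 0 < V n)
    (hpairs : Tendsto (fun n : ℕ => (n : ℝ) ^ (-2 : ℝ) * V n ^ (-1 : ℝ) *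
      avgWeight (a n) 2 2 * M n ^ (2 / 3 : ℝ)) atTop (𝓝 0))
    (htriples : Tendsto (fun n : ℕ => (n : ℝ) ^ (-2 : ℝ) * V n ^ (-(3 / 2) : ℝ) *
      avgWeight (a n) 3 1 * M n) atTop (𝓝 0)) :
    Tendsto (fun n => Var[uStat (a n) (h n); Measure.pi (P n)] / V n) atTop (𝓝 1) ∧
      TendstoInDistribution
        (fun n x => Var[uStat (a n) (h n); Measure.pi (P n)] ^ (-(1 / 2) : ℝ)
          * (uStat (a n) (h n) x - ∫ y, uStat (a n) (h n) y ∂Measure.pi (P n)))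
        atTop (id : ℝ → ℝ) (fun n => Measure.pi (P n)) (gaussianReal 0 1) := by
  have hM2 (n : ℕ) : (M n ^ (1 / 3 : ℝ)) ^ 2 = M n ^ (2 / 3 : ℝ) := by
    rw [← Real.rpow_mul_natCast (hM n)]
    norm_num
  have hM3 (n : ℕ) : (M n ^ (1 / 3 : ℝ)) ^ 3 = M n := by
    rw [← Real.rpow_mul_natCast (hM n)]
    norm_num
  have hinv (n : ℕ) : (n : ℝ) ^ (-2 : ℝ) = ((n : ℝ) ^ 2)⁻¹ := by
    rw [Real.rpow_neg n.cast_nonneg, Real.rpow_two]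
  refine tendsto_variance_div_and_standardized_of_sharingTuples
    (T := fun n t => Finset.univ.image t) (fun n => Real.rpow_nonneg (hM n) (1 / 3))
    (fun n t _ => measurable_comp_tuple (hh n) t) (fun n t _ => dependsOn_comp_tuple (h n) t)
    (fun n t _ => Finset.card_image_le.trans_eq (Finset.card_fin _))
    (fun n t ht => (hmoment n t ht).1) (fun n t ht => (hmoment n t ht).2)
    (fun n => uStat_eq_sum (a n) (h n)) hV hVpos ?_ ?_
  · simp only [hM2, mul_div_right_comm]
    refine tendsto_mul_sum_sharingTuples (K := 1) (hVpos.mono fun n hn => ?_)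
      (hpairs.congr fun n => ?_)
    · exact div_nonneg (Real.rpow_nonneg (hM n) _) hn.le
    · rw [hinv, Real.rpow_neg_one]
      ring
  · simp only [hM3, ← mul_assoc]
    refine tendsto_mul_sum_sharingTuples (K := 2) (hVpos.mono fun n hn => ?_)
      (htriples.congr fun n => ?_)
    · exact mul_nonneg (Real.rpow_nonneg hn.le _) (hM n)
    · rw [hinv]
      ring

end UStatistic

end WeightedU

theorem mainTheorem1_general {𝓧 : ℕ → Type*} [∀ n, MeasurableSpace (𝓧 n)]
    {Ω : ℕ → Type*} [∀ n, MeasurableSpace (Ω n)]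
    (μ : (n : ℕ) → Measure (Ω n)) [∀ n, IsProbabilityMeasure (μ n)]
    (k : ℕ)
    (a : (n : ℕ) → (Fin (k + 1) → Fin n) → ℝ)
    (h : (n : ℕ) → (Fin (k + 1) → 𝓧 n) → ℝ) (hh : ∀ n, Measurable (h n))
    (X : (n : ℕ) → Fin n → Ω n → 𝓧 n) (hX : ∀ n i, Measurable (X n i))
    (hindep : ∀ n, iIndepFun (X n) (μ n))
    (M : ℕ → ℝ) (hM : ∀ n, 0 ≤ M n)
    (hmoment : ∀ n, ∀ t ∈ WeightedU.indexSet n (k + 1),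
      Integrable (fun ω => |h n (fun j => X n (t j) ω)| ^ 3) (μ n) ∧
        ∫ ω, |h n (fun j => X n (t j) ω)| ^ 3 ∂(μ n) ≤ M n)
    (V : ℕ → ℝ) (hV : ∀ n, V n = WeightedU.mainVar (a n) (h n) (μ n) (X n))
    (hVpos : ∀ᶠ n in atTop, 0 < V n)
    (hcond1 : Tendsto (fun n : ℕ => (n : ℝ) ^ (-2 : ℝ) * V n ^ (-1 : ℝ) *
      WeightedU.avgWeight (a n) 2 2 * M n ^ (2 / 3 : ℝ)) atTop (𝓝 0))
    (hcond2 : Tendsto (fun n : ℕ => (n : ℝ) ^ (-2 : ℝ) * V n ^ (-(3 / 2) : ℝ) *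
      WeightedU.avgWeight (a n) 3 1 * M n) atTop (𝓝 0))
    (U : (n : ℕ) → Ω n → ℝ)
    (hU : ∀ n ω, U n ω = WeightedU.uStat (a n) (h n) (fun i => X n i ω)) :
    Tendsto (fun n => variance (U n) (μ n) / V n) atTop (𝓝 1) ∧
      TendstoInDistribution
        (fun n ω => variance (U n) (μ n) ^ (-(1 / 2) : ℝ) * (U n ω - ∫ ω', U n ω' ∂(μ n)))
        atTop (id : ℝ → ℝ) μ (gaussianReal 0 1) := by
  obtain rfl : U = fun n ω => WeightedU.uStat (a n) (h n) fun i => X n i ω := funext₂ hU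
  have (n : ℕ) (i : Fin n) : IsProbabilityMeasure ((μ n).map (X n i)) :=
    Measure.isProbabilityMeasure_map (hX n i).aemeasurable
  have hsample (n : ℕ) := WeightedU.measurePreserving_of_iIndepFun (hX n) (hindep n)
  have hLp (n : ℕ) (t) (ht : t ∈ WeightedU.indexSet n (k + 1)) :=
    WeightedU.memLp_and_lpNorm_le_of_measurePreserving three_ne_zero (hsample n)
      (WeightedU.measurable_comp_tuple (hh n) t).aestronglyMeasurable (hmoment n t ht).1
      (hmoment n t ht).2
  have hV' (n : ℕ) := (hV n).trans <| WeightedU.mainVar_eq_variance_sum_mainEffect (hh n) (hX n)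
    (hindep n) (fun t ht => (hLp n t ht).1.integrable (by norm_num)) (a n)
  exact WeightedU.tendsto_variance_div_and_standardized_comp hsample
    (fun n => WeightedU.measurable_uStat (a n) (hh n)) <|
    WeightedU.tendsto_variance_div_and_standardized_uStat hh hM (by simpa using hLp) hV' hVpos
      hcond1 hcond2

theorem mainTheorem1 {𝓧 : Type*} [MeasurableSpace 𝓧]
    {Ω : ℕ → Type*} [∀ n, MeasurableSpace (Ω n)]
    (μ : (n : ℕ) → Measure (Ω n)) [∀ n, IsProbabilityMeasure (μ n)]
    -- the degree is `m = k + 1`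
    (k : ℕ)
    (a : (n : ℕ) → (Fin (k + 1) → Fin n) → ℝ)
    (h : ℕ → (Fin (k + 1) → 𝓧) → ℝ) (hh : ∀ n, Measurable (h n))
    (X : (n : ℕ) → Fin n → Ω n → 𝓧) (hX : ∀ n i, Measurable (X n i))
    (hindep : ∀ n, iIndepFun (X n) (μ n))
    (M : ℕ → ℝ) (hM : ∀ n, 0 < M n)
    (hmoment : ∀ n, ∀ t ∈ WeightedU.indexSet n (k + 1),
      Integrable (fun ω => h n (fun j => X n (t j) ω) ^ 4) (μ n) ∧
        ∫ ω, h n (fun j => X n (t j) ω) ^ 4 ∂(μ n) ≤ M n)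
    (V : ℕ → ℝ) (hV : ∀ n, V n = WeightedU.mainVar (a n) (h n) (μ n) (X n))
    (hVpos : ∀ᶠ n in atTop, 0 < V n)
    (hcond1 : Tendsto (fun n : ℕ => (n : ℝ) ^ (-2 : ℝ) * V n ^ (-1 : ℝ) *
      WeightedU.avgWeight (a n) 2 2 * M n ^ (1 / 2 : ℝ)) atTop (𝓝 0))
    (hcond2 : Tendsto (fun n : ℕ => (n : ℝ) ^ (-2 : ℝ) * V n ^ (-(3 / 2) : ℝ) *
      WeightedU.avgWeight (a n) 3 1 * M n ^ (3 / 4 : ℝ)) atTop (𝓝 0))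
    (U : (n : ℕ) → Ω n → ℝ)
    (hU : ∀ n ω, U n ω = WeightedU.uStat (a n) (h n) (fun i => X n i ω)) :
    Tendsto (fun n => variance (U n) (μ n) / V n) atTop (𝓝 1) ∧
      TendstoInDistribution
        (fun n ω => variance (U n) (μ n) ^ (-(1 / 2) : ℝ) * (U n ω - ∫ ω', U n ω' ∂(μ n)))
        atTop (id : ℝ → ℝ) μ (gaussianReal 0 1) := by
  have hrpow (n : ℕ) : (M n ^ (3 / 4 : ℝ)) ^ (2 / 3 : ℝ) = M n ^ (1 / 2 : ℝ) := by
    rw [← Real.rpow_mul (hM n).le]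
    norm_num
  exact mainTheorem1_general μ k a h hh X hX hindep (fun n => M n ^ (3 / 4 : ℝ))
    (fun n => Real.rpow_nonneg (hM n).le _)
    (fun n t ht => WeightedU.integrable_abs_cube_and_integral_le_rpow
      ((hh n).comp (measurable_pi_lambda _ fun j => hX n (t j))).aestronglyMeasurable
      (hmoment n t ht).1 (hmoment n t ht).2)
    V hV hVpos (by simpa only [hrpow] using hcond1) hcond2 U hU
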